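/- **Setting.** Let $L\ge 3$ and $A,B\ge 0$ be integers, $0<\lambda<1$, and $\sigma^2,\gamma_p,\theta_p,\theta_s>0$. A single-antenna primary link has channel $h_p\sim\mathcal{CN}(0,1)$ and gain $g_p=|h_p|^2$. A secondary transmitter with $L$ antennas has channel $\mathbf h_x\in\mathbb C^L$ to the primary receiver, with i.i.d. $\mathcal{CN}(0,\lambda)$ entries, and channel $\mathbf h_s\in\mathbb C^L$ to the (single-antenna) secondary receiver, with i.i.d. $\mathcal{CN}(0,1)$ entries. The three channels are independent. Put $g_x=\|\mathbf h_x\|^2/\lambda$, $g_s=\|\mathbf h_s\|^2$, $\mathbf s_x=\mathbf h_x/\|\mathbf h_x\|$, $\mathbf s_s=\mathbf h_s/\|\mathbf h_s\|$. *CDI feedback.* The unit vector $\hat{\mathbf s}_x$ is obtained from $\mathbf s_x$ by a $B$-bit quantizer, modelled as a (possibly randomized) function of $\mathbf s_x$ whose private randomness is independent of the three channels and whose error $\epsilon=1-|\hat{\mathbf s}_x^\dagger\mathbf s_x|^2$ satisfies $\Pr(\epsilon\le\tau)=2^B\tau^{L-1}$ for $0\le\tau\le 2^{-B/(L-1)}$.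 *IPC feedback (without feedforward).* Let $P_{\max}>0$ be the maximum secondary transmit power, $\omega=\sigma^2(\gamma_pg_p/\theta_p-1)$, and let $\eta=\omega/(\lambda g_x\epsilon)$ if $\omega\ge0$, $\eta=P_{\max}$ otherwise. Let $N=2^A$ and let $\mathcal P=\{p_0<\dots<p_{N-1}\}$ be the equal-probability codebook: $p_0=0$, $\Pr(p_n<\eta\le p_{n+1}\mid\gamma_pg_p\ge\theta_p)=1/N$ for $0\le n\le N-2$, and $\Pr(\eta>p_{N-1}\mid\gamma_pg_p\ge\theta_p)=1/N$. The quantized signal is $\hat\eta=\max\{p\in\mathcal P:p\le\eta\}$ if $\omega\ge0$ and $\eta<P_{\max}$, and $\hat\eta=P_{\max}$ otherwise. *Orthogonal cognitive beamforming (OCB).* The beamformer $\mathbf f$ maximizes $|\mathbf f^\dagger\mathbf s_s|^2$ subject to $\mathbf f^\dagger\hat{\mathbf s}_x=0$ and $\|\mathbf f\|^2\le\hat\eta$. The outage probability of the secondary link is $$\hat P_{\mathrm{out}}(P_{\max})=\Pr\Big(\frac{g_s}{\sigma^2}\,|\mathbf f^\dagger\mathbf s_s|^2\le\theta_s\Big).$$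 **Statement.** Let $\gamma_{\max}=P_{\max}/\sigma^2$ and $\Gamma(a,x)=\int_x^\infty t^{a-1}e^{-t}\,dt$, and define $$U(P_{\max})=1-\frac{\Gamma(L-1,\theta_s/\gamma_{\max})}{\Gamma(L-1)}+\varphi\,2^{-\frac B{L-1}}+\alpha\,2^{-A},$$ $$\varphi=e^{-\theta_p/\gamma_p}\,\frac{(L-1)\lambda\theta_p\theta_s\,\Gamma(L-2,\theta_s/\gamma_{\max})}{\gamma_p\,\Gamma(L-1)},\qquad \alpha=e^{-\theta_p/\gamma_p}\,\frac{\Gamma(L-1,\theta_s/\gamma_{\max})}{\Gamma(L-1)}.$$ Then $\hat P_{\mathrm{out}}(P_{\max})\le U(P_{\max})$ for every $P_{\max}>0$, and, as $P_{\max}\to\infty$ with the other parameters fixed, $U(P_{\max})$ converges to $\varphi'2^{-B/(L-1)}+\alpha'2^{-A}$, where $$\varphi'=e^{-\theta_p/\gamma_p}\,\frac{(L-1)\lambda\theta_p\theta_s}{(L-2)\gamma_p},\qquad \alpha'=e^{-\theta_p/\gamma_p}.$$ Moreover $\lim_{P_{\max}\to\infty}\hat P_{\mathrm{out}}(P_{\max})$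 exists and $$\lim_{P_{\max}\to\infty}\hat P_{\mathrm{out}}(P_{\max})\le\varphi'\,2^{-\frac B{L-1}}+\alpha'\,2^{-A}.$$ -/

import Mathlib

open MeasureTheory ProbabilityTheory Filter Topology

noncomputable section

namespace CognitiveBeamforming

/-- Deterministic parameters: `L` antennas at the secondary transmitter, `A` bits for the
interference-power-control (IPC) signal, `B` bits for the channel-direction information (CDI),
path-loss factor `lam`, noise variance `sigma2`, primary transmit SNR `gammaP`, and the primary and
secondary SINR/SNR thresholds `thetaP`, `thetaS`. -/
structure Params where
  L : ℕ
  A : ℕ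
  B : ℕ
  lam : ℝ
  sigma2 : ℝ
  gammaP : ℝ
  thetaP : ℝ
  thetaS : ℝ
  one_lt_L : 1 < L
  lam_pos : 0 < lam
  lam_lt_one : lam < 1
  sigma2_pos : 0 < sigma2
  gammaP_pos : 0 < gammaP
  thetaP_pos : 0 < thetaP
  thetaS_pos : 0 < thetaS

/-- Column vectors in `ℂ^L` with the Euclidean norm; `inner ℂ x y` is `x† y`. -/
abbrev Vec (L : ℕ) := EuclideanSpace ℂ (Fin L)

/-- The circularly symmetric complex Gaussian law `CN(0, v)`: independent real and imaginary parts,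
each centred Gaussian with variance `v / 2`. -/
def complexGaussian (v : ℝ) : Measure ℂ :=
  ((gaussianReal 0 (v / 2).toNNReal).prod (gaussianReal 0 (v / 2).toNNReal)).map
    Complex.measurableEquivRealProd.symm

/-- The random vector `h` has i.i.d. `CN(0, v)` entries. -/
def IsIIDComplexGaussian {Ω : Type*} [MeasurableSpace Ω] (μ : Measure Ω) {L : ℕ}
    (h : Ω → Vec L) (v : ℝ) : Prop :=
  iIndepFun (fun (i : Fin L) (ω : Ω) => h ω i) μ ∧
    ∀ i : Fin L, HasLaw (fun ω => h ω i) (complexGaussian v) μ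

/-- The shape `h / ‖h‖` of a channel vector. -/
def shape {L : ℕ} (h : Vec L) : Vec L := ((‖h‖⁻¹ : ℝ) : ℂ) • h

/-- The CDI quantization error `1 - |ŝ† s|²`. -/
def quantError {L : ℕ} (shat s : Vec L) : ℝ := 1 - ‖inner ℂ shat s‖ ^ 2

/-- The random channel model. `hp` is the primary channel, `hx` the channel from the secondary
transmitter to the primary receiver, `hs` the channel from the secondary transmitter to the
secondary receiver; they fade independently. The CDI quantizer sees only the shape of `hx` and may
use a private random seed (which makes the error law below attainable). -/
structure Channel (S : Params) {Ω : Type*} [MeasurableSpace Ω] (μ : Measure Ω)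
    (V : Type*) [MeasurableSpace V] where
  hp : Ω → ℂ
  hx : Ω → Vec S.L
  hs : Ω → Vec S.L
  seed : Ω → V
  quantizer : Vec S.L × V → Vec S.L
  measurable_hp : Measurable hp
  measurable_hx : Measurable hx
  measurable_hs : Measurable hs
  measurable_seed : Measurable seed
  measurable_quantizer : Measurable quantizer
  law_hp : HasLaw hp (complexGaussian 1) μ
  law_hx : IsIIDComplexGaussian μ hx S.lam
  law_hs : IsIIDComplexGaussian μ hs 1
  /- the next three fields say that `hp`, `hs`, `hx`, `seed` are mutually independent -/
  indep_hs : IndepFun hs (fun ω => (hp ω, hx ω, seed ω)) μ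
  indep_hp : IndepFun hp (fun ω => (hx ω, seed ω)) μ
  indep_hx : IndepFun hx seed μ
  /-- The quantized CDI is a unit vector. -/
  norm_quantizer : ∀ᵐ ω ∂μ, ‖quantizer (shape (hx ω), seed ω)‖ = 1
  /-- The distribution function of the quantization error. -/
  quantError_cdf : ∀ τ : ℝ, 0 ≤ τ → τ ≤ (2 : ℝ) ^ (-((S.B : ℝ) / ((S.L : ℝ) - 1))) →
    μ.real {ω | quantError (quantizer (shape (hx ω), seed ω)) (shape (hx ω)) ≤ τ}
      = (2 : ℝ) ^ S.B * τ ^ (S.L - 1)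

namespace Channel

variable {S : Params} {Ω : Type*} [MeasurableSpace Ω] {μ : Measure Ω}
  {V : Type*} [MeasurableSpace V] (C : Channel S μ V)

/-- Primary channel gain. -/
def gp (ω : Ω) : ℝ := ‖C.hp ω‖ ^ 2

/-- Gain of the secondary-transmitter-to-primary-receiver channel, normalized by the path loss. -/
def gx (ω : Ω) : ℝ := ‖C.hx ω‖ ^ 2 / S.lam

/-- Secondary channel gain. -/
def gs (ω : Ω) : ℝ := ‖C.hs ω‖ ^ 2

/-- Shape of the secondary-transmitter-to-primary-receiver channel (the CDI). -/
def sx (ω : Ω) : Vec S.L := shape (C.hx ω)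

/-- Shape of the secondary channel. -/
def ss (ω : Ω) : Vec S.L := shape (C.hs ω)

/-- Quantized CDI. -/
def sxhat (ω : Ω) : Vec S.L := C.quantizer (C.sx ω, C.seed ω)

/-- CDI quantization error `ε`. -/
def eps (ω : Ω) : ℝ := quantError (C.sxhat ω) (C.sx ω)

/-- Interference margin `ω = σ² (γ_p g_p / θ_p - 1)` of the primary receiver. -/
def margin (ω : Ω) : ℝ := S.sigma2 * (S.gammaP * C.gp ω / S.thetaP - 1)

open Classical in
/-- Unquantized IPC signal `η` (no feedforward). -/
def eta (Pmax : ℝ) (ω : Ω) : ℝ :=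
  if 0 ≤ C.margin ω then C.margin ω / (S.lam * C.gx ω * C.eps ω) else Pmax

/-- The event that the primary link is not in outage, `γ_p g_p ≥ θ_p`. -/
def noPrimaryOutage : Set Ω := {ω | S.thetaP ≤ S.gammaP * C.gp ω}

/-- `p 0 < p 1 < ⋯ < p (2^A - 1)` is the equal-probability IPC codebook (values of `p` at larger
indices are irrelevant). -/
structure IsCodebook (Pmax : ℝ) (p : ℕ → ℝ) : Prop where
  zero : p 0 = 0
  strictMono : StrictMonoOn p (Set.Iio (2 ^ S.A))
  cell : ∀ n : ℕ, n + 1 < 2 ^ S.A →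
    (ProbabilityTheory.cond μ C.noPrimaryOutage).real
      {ω | p n < C.eta Pmax ω ∧ C.eta Pmax ω ≤ p (n + 1)} = 1 / (2 : ℝ) ^ S.A
  last : (ProbabilityTheory.cond μ C.noPrimaryOutage).real
      {ω | p (2 ^ S.A - 1) < C.eta Pmax ω} = 1 / (2 : ℝ) ^ S.A

/-- `⌊x⌋_𝒫`: the largest codebook element not exceeding `x` (for `x ≥ 0 = p 0`, the supremum is that
of a finite nonempty set). -/
def codebookFloor (A : ℕ) (p : ℕ → ℝ) (x : ℝ) : ℝ :=
  sSup (p '' Set.Iio (2 ^ A) ∩ Set.Iic x)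

open Classical in
/-- Quantized IPC signal `η̂`. -/
def etahat (Pmax : ℝ) (p : ℕ → ℝ) (ω : Ω) : ℝ :=
  if 0 ≤ C.margin ω ∧ C.eta Pmax ω < Pmax then codebookFloor S.A p (C.eta Pmax ω) else Pmax

end Channel

/-- `f` is an orthogonal cognitive beamformer: it maximizes `|f† s|²` subject to `f† ŝ = 0` and
`‖f‖² ≤ P`. -/
structure IsOCBeamformer {L : ℕ} (shat s : Vec L) (P : ℝ) (f : Vec L) : Prop where
  orthogonal : inner ℂ f shat = 0
  power : ‖f‖ ^ 2 ≤ P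
  optimal : ∀ g : Vec L, inner ℂ g shat = 0 → ‖g‖ ^ 2 ≤ P →
    ‖inner ℂ g s‖ ^ 2 ≤ ‖inner ℂ f s‖ ^ 2

/-- Secondary outage probability `Pr(SNR_s ≤ θ_s)`, `SNR_s = (g_s / σ²) |f† s_s|²`, for the random
beamformer `f`. -/
def outageProb {S : Params} {Ω : Type*} [MeasurableSpace Ω] {μ : Measure Ω}
    {V : Type*} [MeasurableSpace V] (C : Channel S μ V) (f : Ω → Vec S.L) : ℝ :=
  μ.real {ω | C.gs ω / S.sigma2 * ‖inner ℂ (f ω) (C.ss ω)‖ ^ 2 ≤ S.thetaS}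

/-- Upper incomplete gamma function `Γ(a, x)`. -/
def incGamma (a x : ℝ) : ℝ := ∫ t in Set.Ioi x, t ^ (a - 1) * Real.exp (-t)

namespace Params

variable (S : Params)

/-- `θ_s / γ_max` with `γ_max = Pmax / σ²`. -/
def ratio (Pmax : ℝ) : ℝ := S.thetaS / (Pmax / S.sigma2)

/-- The coefficient `φ`. -/
def phi (Pmax : ℝ) : ℝ :=
  Real.exp (-(S.thetaP / S.gammaP)) *
    ((((S.L : ℝ) - 1) * S.lam * S.thetaP * S.thetaS * incGamma ((S.L : ℝ) - 2) (S.ratio Pmax)) /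
      (S.gammaP * Real.Gamma ((S.L : ℝ) - 1)))

/-- The coefficient `α`. -/
def alpha (Pmax : ℝ) : ℝ :=
  Real.exp (-(S.thetaP / S.gammaP)) *
    (incGamma ((S.L : ℝ) - 1) (S.ratio Pmax) / Real.Gamma ((S.L : ℝ) - 1))

/-- The upper bound on the outage probability with quantized CDI and IPC feedback. -/
def outageBound (Pmax : ℝ) : ℝ :=
  1 - incGamma ((S.L : ℝ) - 1) (S.ratio Pmax) / Real.Gamma ((S.L : ℝ) - 1)
    + S.phi Pmax * (2 : ℝ) ^ (-((S.B : ℝ) / ((S.L : ℝ) - 1)))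
    + S.alpha Pmax * (2 : ℝ) ^ (-(S.A : ℝ))

/-- The limiting coefficient `φ'`. -/
def phi' : ℝ :=
  Real.exp (-(S.thetaP / S.gammaP)) *
    ((((S.L : ℝ) - 1) * S.lam * S.thetaP * S.thetaS) / (((S.L : ℝ) - 2) * S.gammaP))

/-- The limiting coefficient `α'`. -/
def alpha' : ℝ := Real.exp (-(S.thetaP / S.gammaP))

/-- The limiting bound `φ' 2^{-B/(L-1)} + α' 2^{-A}`. -/
def limitBound : ℝ :=
  S.phi' * (2 : ℝ) ^ (-((S.B : ℝ) / ((S.L : ℝ) - 1))) + S.alpha' * (2 : ℝ) ^ (-(S.A : ℝ))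

end Params

end CognitiveBeamforming

end

noncomputable section

namespace CognitiveBeamforming

open scoped ENNReal

/-! ### Gaussian laws as radial densities: norm and direction -/

section RadialGaussian

/-! The optimal beamformer points along the projection of the secondary channel orthogonal to the
quantized CDI (`IsOCBeamformer.norm_inner_sq`), so outage is the event `R * η̂ ≤ θ_s σ²`, where `R`
is the residual gain of that channel. Rotation invariance makes `R` a Gamma(`L - 1`) variable
independent of the interference gain `W = λ g_x ε` and of `g_p` (`map_residualGain_prod`), and `η̂`
depends only on `W` and `g_p`. One may therefore fix `R = g` and integrate over `g`.

If `g ≤ θ_s / γ_max`, bound the conditional outage probability by one; this gives the term `1 -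
Γ(L-1, ·)/Γ(L-1)`. For larger `g`, the value `η̂ = P_max` is excluded, so the primary link is not in
outage and the rounded `η` is at most `t = θ_s σ² / g`. Rounding down costs at most one codebook
cell, of mass `e^{-a} 2^{-A}` with `a = θ_p / γ_p`. What remains is `η ≤ t`, which says that the
exponential variable `g_p` lies between `a` and `a + (a/σ²) t W`; its probability is at most `e^{-a}
(a/σ²) t E[W]`. Independence of norm and direction of `h_x` gives `E[W] = λ (L-1) 2^{-B/(L-1)}`
(`lintegral_interferenceGain`). Integrating `1/g` against the gamma density yields `Γ(L-2,
·)/Γ(L-1)`, hence `φ`.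

For the limit, `η` does not involve `P_max` off primary outage and charges every nondegenerate
interval of nonnegative reals, so the codebook is the same for all `P_max` (`codebook_unique`). The
outage indicators then converge almost surely, and dominated convergence applies. -/

theorem map_withDensity_comp {α β : Type*} [MeasurableSpace α] [MeasurableSpace β] {m : Measure α}
    {e : α → β} (he : Measurable e) {g : β → ℝ≥0∞} (hg : Measurable g) :
    (m.withDensity (fun x => g (e x))).map e = (m.map e).withDensity g := by
  ext s hs
  rw [Measure.map_apply he hs, withDensity_apply _ (he hs), withDensity_apply _ hs,
    setLIntegral_map hs hg he]

/-- `γ` has density `exp (-‖x‖² / v)` with respect to some Haar measure. -/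
def IsRadialGaussian {E : Type*} [NormedAddCommGroup E] [MeasurableSpace E] (γ : Measure E)
    (v : ℝ) : Prop :=
  ∃ H : Measure E, H.IsAddHaarMeasure ∧
    γ = H.withDensity fun x => ENNReal.ofReal (Real.exp (-(‖x‖ ^ 2 / v)))

variable {E F : Type*} [NormedAddCommGroup E] [NormedSpace ℝ E]
  [MeasurableSpace E] [BorelSpace E] [NormedAddCommGroup F] [NormedSpace ℝ F]
  [MeasurableSpace F] [BorelSpace F]

theorem IsRadialGaussian.map {γ : Measure E} {v : ℝ} (h : IsRadialGaussian γ v) (e : E ≃ₗᵢ[ℝ] F) :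
    IsRadialGaussian (γ.map e) v := by
  obtain ⟨H, hH, rfl⟩ := h
  refine ⟨H.map e, e.toContinuousLinearEquiv.isAddHaarMeasure_map H, ?_⟩
  rw [← map_withDensity_comp e.continuous.measurable (by fun_prop)]
  simp

variable [FiniteDimensional ℝ E]

/-- Haar measures are proportional and total mass one fixes the factor. Leaving the Haar measure
unspecified thus avoids computing any normalizing constant; with `IsRadialGaussian.map` this gives
rotation invariance. -/
theorem IsRadialGaussian.eq {γ γ' : Measure E} [IsProbabilityMeasure γ] [IsProbabilityMeasure γ']
    {v : ℝ} (h : IsRadialGaussian γ v) (h' : IsRadialGaussian γ' v) : γ = γ' := by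
  obtain ⟨H, hH, rfl⟩ := h
  obtain ⟨H', hH', rfl⟩ := h'
  have key := Measure.isAddLeftInvariant_eq_smul H H'
  set c := Measure.addHaarScalarFactor H H' with hc
  set d : E → ℝ≥0∞ := fun x => ENNReal.ofReal (Real.exp (-(‖x‖ ^ 2 / v))) with hd
  have h1 : H.withDensity d = c • H'.withDensity d := by
    rw [key]; exact withDensity_smul_measure c d
  have h2 : (c : ℝ≥0∞) = 1 := by
    have := congrArg (fun m : Measure E => m Set.univ) h1
    simpa using this.symm
  rw [h1]
  simp only [ENNReal.coe_eq_one] at h2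
  rw [h2, one_smul]

theorem IsRadialGaussian.measure_singleton_zero {γ : Measure E} {v : ℝ}
    (h : IsRadialGaussian γ v) [Nontrivial E] : γ {0} = 0 := by
  obtain ⟨H, hH, rfl⟩ := h
  exact withDensity_absolutelyContinuous _ _ (measure_singleton 0)

/-- Integration in polar coordinates. -/
theorem lintegral_norm_mul_direction [Nontrivial E] (H : Measure E) [H.IsAddHaarMeasure]
    {f : ℝ → ℝ≥0∞} (hf : Measurable f) {φ : E → ℝ≥0∞} (hφ : Measurable φ) :
    ∫⁻ x, f ‖x‖ * φ (‖x‖⁻¹ • x) ∂H =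
      (∫⁻ s : Metric.sphere (0 : E) 1, φ s ∂H.toSphere) *
        ∫⁻ r in Set.Ioi (0 : ℝ), ENNReal.ofReal (r ^ (Module.finrank ℝ E - 1)) * f r := by
  have h1 : ∫⁻ x, f ‖x‖ * φ (‖x‖⁻¹ • x) ∂H =
      ∫⁻ x : ({(0)}ᶜ : Set E), f ‖x.1‖ * φ (‖x.1‖⁻¹ • x.1) ∂(H.comap (↑)) := by
    rw [lintegral_subtype_comap (measurableSet_singleton _).compl
      (fun x : E => f ‖x‖ * φ (‖x‖⁻¹ • x)), restrict_compl_singleton]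
  have h2 := (H.measurePreserving_homeomorphUnitSphereProd).lintegral_comp
    (f := fun p : Metric.sphere (0 : E) 1 × Set.Ioi (0 : ℝ) => f p.2.1 * φ p.1.1) (by fun_prop)
  rw [h1]
  simp only [homeomorphUnitSphereProd_apply_snd_coe, homeomorphUnitSphereProd_apply_fst_coe] at h2
  rw [h2, lintegral_prod _ (by fun_prop)]
  simp_rw [mul_comm (f _)]
  have h3 : ∀ s : Metric.sphere (0 : E) 1,
      ∫⁻ r : Set.Ioi (0 : ℝ), φ s * f r.1 ∂(Measure.volumeIoiPow (Module.finrank ℝ E - 1)) =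
      φ s * ∫⁻ r : Set.Ioi (0 : ℝ), f r.1 ∂(Measure.volumeIoiPow (Module.finrank ℝ E - 1)) :=
    fun s => lintegral_const_mul _ (by fun_prop)
  simp_rw [h3]
  rw [lintegral_mul_const _ (by fun_prop)]
  congr 1
  rw [Measure.volumeIoiPow, lintegral_withDensity_eq_lintegral_mul _ (by fun_prop) (by fun_prop)]
  exact lintegral_subtype_comap measurableSet_Ioi
    (fun r : ℝ => ENNReal.ofReal (r ^ (Module.finrank ℝ E - 1)) * f r)

theorem lintegral_gammaMeasure {a r : ℝ} {f : ℝ → ℝ≥0∞} (hf : Measurable f) :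
    ∫⁻ x, f x ∂(gammaMeasure a r) = ∫⁻ x in Set.Ioi (0 : ℝ), gammaPDF a r x * f x := by
  have hm : Measurable (gammaPDF a r) := (measurable_gammaPDFReal a r).ennreal_ofReal
  rw [gammaMeasure, lintegral_withDensity_eq_lintegral_mul _ hm hf,
    ← lintegral_add_compl _ (measurableSet_Ioi (a := (0 : ℝ))), Set.compl_Ioi]
  have : ∫⁻ x in Set.Iic (0 : ℝ), (gammaPDF a r * f) x = 0 := by
    rw [setLIntegral_congr Iio_ae_eq_Iic.symm, setLIntegral_congr_fun measurableSet_Iio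
      (g := fun _ => 0)]
    · simp
    · intro x hx
      simp [gammaPDF_of_neg (Set.mem_Iio.1 hx)]
  rw [this, add_zero]
  rfl

/-- The substitution `x = r²` on the half line. -/
theorem lintegral_Ioi_comp_sq (g : ℝ → ℝ≥0∞) :
    ∫⁻ r in Set.Ioi (0 : ℝ), ENNReal.ofReal (2 * r) * g (r ^ 2) = ∫⁻ x in Set.Ioi (0 : ℝ), g x := by
  have himg : (fun r : ℝ => r ^ 2) '' Set.Ioi (0 : ℝ) = Set.Ioi 0 := by
    ext x
    constructor
    · rintro ⟨r, hr, rfl⟩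
      exact pow_pos (Set.mem_Ioi.1 hr) 2
    · intro hx
      exact ⟨√x, Real.sqrt_pos.2 hx, Real.sq_sqrt (le_of_lt hx)⟩
  have := lintegral_image_eq_lintegral_abs_deriv_mul (s := Set.Ioi (0 : ℝ))
    (f := fun r : ℝ => r ^ 2) (f' := fun r => 2 * r) measurableSet_Ioi
    (fun x _ => by simpa using (hasDerivAt_pow 2 x).hasDerivWithinAt)
    (fun x hx y hy h => by
      simpa using (pow_left_inj₀ (le_of_lt hx) (le_of_lt hy) two_ne_zero).1 h) g
  rw [himg] at this
  rw [this]
  refine setLIntegral_congr_fun measurableSet_Ioi fun x hx => ?_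
  rw [abs_of_pos (by have := Set.mem_Ioi.1 hx; positivity)]

/-- Under `x = r²` the radial weight becomes an unnormalized gamma density; the constant is its
normalization, halved by the Jacobian `2r`. -/
theorem lintegral_radial_gammaMeasure {n : ℕ} (hn : 0 < n) {v : ℝ} (hv : 0 < v) {f : ℝ → ℝ≥0∞}
    (hf : Measurable f) :
    ∫⁻ r in Set.Ioi (0 : ℝ), ENNReal.ofReal (r ^ (2 * n - 1)) *
        (ENNReal.ofReal (Real.exp (-(r ^ 2 / v))) * f (r ^ 2)) =
      ENNReal.ofReal (v ^ n * Real.Gamma n / 2) * ∫⁻ x, f x ∂(gammaMeasure n (1 / v)) := by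
  rw [lintegral_gammaMeasure hf, ← lintegral_const_mul _ (by
    have := (measurable_gammaPDFReal n (1 / v)).ennreal_ofReal
    exact this.mul hf)]
  conv_rhs => rw [← lintegral_Ioi_comp_sq]
  refine setLIntegral_congr_fun measurableSet_Ioi fun r hr => ?_
  have hr : 0 < r := hr
  rw [gammaPDF_of_nonneg (by positivity), ← mul_assoc, ← mul_assoc, ← mul_assoc,
    ← ENNReal.ofReal_mul (by positivity), ← ENNReal.ofReal_mul (by positivity),
    ← ENNReal.ofReal_mul (by positivity)]
  congr 2
  have hG : Real.Gamma n ≠ 0 := (Real.Gamma_pos_of_pos (by exact_mod_cast hn)).ne'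
  obtain ⟨m, rfl⟩ : ∃ m, n = m + 1 := ⟨n - 1, by omega⟩
  have e1 : ((r ^ 2 : ℝ) ^ (((m + 1 : ℕ) : ℝ) - 1)) = r ^ (2 * m) := by
    rw [Nat.cast_add, Nat.cast_one, add_sub_cancel_right, Real.rpow_natCast, ← pow_mul]
  have e2 : 2 * (m + 1) - 1 = 2 * m + 1 := by omega
  rw [e1, e2, Real.rpow_natCast, one_div_mul_eq_div, one_div, inv_pow]
  field_simp
  ring

/-- Independence of squared norm and direction, since polar coordinates factor a radial density. -/
theorem IsRadialGaussian.lintegral_eq {γ : Measure E} [IsProbabilityMeasure γ] {v : ℝ}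
    (hv : 0 < v) (h : IsRadialGaussian γ v) {n : ℕ} (hn : 0 < n) (hE : Module.finrank ℝ E = 2 * n)
    {f : ℝ → ℝ≥0∞} (hf : Measurable f) {φ : E → ℝ≥0∞} (hφ : Measurable φ) :
    ∫⁻ x, f (‖x‖ ^ 2) * φ (‖x‖⁻¹ • x) ∂γ =
      (∫⁻ t, f t ∂(gammaMeasure n (1 / v))) * ∫⁻ x, φ (‖x‖⁻¹ • x) ∂γ := by
  obtain ⟨H, hH, rfl⟩ := h
  have : Nontrivial E := Module.nontrivial_of_finrank_pos (R := ℝ) (by omega)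
  have hpos : (0 : ℝ) < n := by exact_mod_cast hn
  have := isProbabilityMeasure_gammaMeasure hpos (one_div_pos.2 hv)
  have key : ∀ f : ℝ → ℝ≥0∞, Measurable f → ∫⁻ x, f (‖x‖ ^ 2) * φ (‖x‖⁻¹ • x)
      ∂(H.withDensity fun x => ENNReal.ofReal (Real.exp (-(‖x‖ ^ 2 / v)))) =
      (∫⁻ s : Metric.sphere (0 : E) 1, φ s ∂H.toSphere) *
      (ENNReal.ofReal (v ^ n * Real.Gamma n / 2) * ∫⁻ x, f x ∂(gammaMeasure n (1 / v))) := by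
    intro f hf
    rw [lintegral_withDensity_eq_lintegral_mul _ (by fun_prop) (by fun_prop),
      ← lintegral_radial_gammaMeasure hn hv hf, ← hE,
      ← lintegral_norm_mul_direction H
        (f := fun r => ENNReal.ofReal (Real.exp (-(r ^ 2 / v))) * f (r ^ 2)) (by fun_prop) hφ]
    simp only [Pi.mul_apply, mul_assoc]
  -- The case `f = 1` identifies the spherical integral times the constant, so the area of the
  -- sphere is never needed.
  have h1 := key (fun _ => 1) measurable_const
  simp only [one_mul, lintegral_const, measure_univ, mul_one] at h1
  rw [key f hf, h1, ← mul_assoc, mul_comm]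

theorem IsRadialGaussian.map_norm_sq {γ : Measure E} [IsProbabilityMeasure γ] {v : ℝ}
    (hv : 0 < v) (h : IsRadialGaussian γ v) {n : ℕ} (hn : 0 < n)
    (hE : Module.finrank ℝ E = 2 * n) :
    γ.map (fun x => ‖x‖ ^ 2) = gammaMeasure n (1 / v) := by
  ext s hs
  have := h.lintegral_eq hv hn hE (f := s.indicator 1) (measurable_one.indicator hs)
    (φ := fun _ => 1) measurable_const
  simp only [mul_one, lintegral_const, measure_univ] at this
  rw [lintegral_indicator_one hs] at this
  rw [← this, Measure.map_apply (by fun_prop) hs,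
    ← lintegral_indicator_one ((by fun_prop : Measurable fun x : E => ‖x‖ ^ 2) hs)]
  rfl

end RadialGaussian

/-! ### Complex Gaussian vectors and their projections -/

section ComplexGaussian

theorem isRadialGaussian_complexGaussian {v : ℝ} (hv : 0 < v) :
    IsRadialGaussian (complexGaussian v) v := by
  have hw : (v / 2).toNNReal ≠ 0 := (Real.toNNReal_pos.2 (by positivity)).ne'
  -- `K` normalizes each real coordinate; `K * K` is absorbed into the Haar measure.
  set K : ℝ := (√(2 * Real.pi * (v / 2).toNNReal))⁻¹ with hK
  have hK0 : 0 < K := inv_pos.2 (Real.sqrt_pos.2 (by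
    have : (0 : ℝ) < (v / 2).toNNReal := by exact_mod_cast Real.toNNReal_pos.2 (by positivity)
    positivity))
  have hm := measurable_gaussianPDF 0 (v / 2).toNNReal
  have hc : ENNReal.ofReal (K * K) ≠ 0 := by
    rw [Ne, ENNReal.ofReal_eq_zero, not_le]; positivity
  refine ⟨ENNReal.ofReal (K * K) • volume,
    Measure.IsAddHaarMeasure.smul _ hc ENNReal.ofReal_ne_top, ?_⟩
  have hmp := Complex.volume_preserving_equiv_real_prod.symm
  have hmap : (volume : Measure (ℝ × ℝ)).map Complex.measurableEquivRealProd.symm = volume :=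
    hmp.map_eq
  have h1 := map_withDensity_comp (m := (volume : Measure (ℝ × ℝ)))
    Complex.measurableEquivRealProd.symm.measurable
    (g := fun z : ℂ => gaussianPDF 0 (v / 2).toNNReal z.re * gaussianPDF 0 (v / 2).toNNReal z.im)
    (by fun_prop)
  rw [complexGaussian, gaussianReal_of_var_ne_zero _ hw, prod_withDensity hm hm,
    ← Measure.volume_eq_prod]
  refine h1.trans ?_
  rw [hmap, withDensity_smul_measure, ← withDensity_smul _ (by fun_prop)]
  congr 1
  ext z
  have hcoe : (((v / 2).toNNReal : NNReal) : ℝ) = v / 2 := Real.coe_toNNReal _ (by positivity)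
  simp only [gaussianPDF, gaussianPDFReal, Pi.smul_apply, smul_eq_mul]
  rw [← ENNReal.ofReal_mul (by positivity), ← ENNReal.ofReal_mul (by positivity), hcoe]
  congr 1
  rw [hK, hcoe, Complex.sq_norm, Complex.normSq_apply]
  have : -((z.re * z.re + z.im * z.im) / v) =
      -(z.re - 0) ^ 2 / (2 * (v / 2)) + -(z.im - 0) ^ 2 / (2 * (v / 2)) := by
    field_simp; ring
  rw [this, Real.exp_add]
  ring

instance isProbabilityMeasure_complexGaussian (v : ℝ) :
    IsProbabilityMeasure (complexGaussian v) :=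
  Measure.isProbabilityMeasure_map Complex.measurableEquivRealProd.symm.measurable.aemeasurable

theorem lintegral_pi_fin_prod {α : Type*} [MeasurableSpace α] (m : Measure α) [SigmaFinite m]
    {n : ℕ} {f : Fin n → α → ℝ≥0∞} (hf : ∀ i, Measurable (f i)) :
    ∫⁻ x, ∏ i, f i (x i) ∂(Measure.pi fun _ : Fin n => m) = ∏ i, ∫⁻ a, f i a ∂m := by
  induction n with
  | zero => simp
  | succ n ih =>
    have h := (measurePreserving_piFinSuccAbove (fun _ : Fin (n + 1) => m) 0).symm
    rw [← h.lintegral_comp (by fun_prop), lintegral_prod _ (by fun_prop), Fin.prod_univ_succ,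
      ← ih (fun i => hf _), ← lintegral_mul_const _ (hf 0)]
    refine lintegral_congr fun a => ?_
    rw [← lintegral_const_mul _ (by fun_prop)]
    refine lintegral_congr fun x => ?_
    simp [Fin.prod_univ_succ, MeasurableEquiv.piFinSuccAbove]

theorem pi_withDensity {α : Type*} [MeasurableSpace α] (m : Measure α) [SigmaFinite m]
    {n : ℕ} {f : α → ℝ≥0∞} (hf : Measurable f) [SigmaFinite (m.withDensity f)] :
    (Measure.pi fun _ : Fin n => m.withDensity f) =
      (Measure.pi fun _ : Fin n => m).withDensity fun x => ∏ i, f (x i) := by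
  refine Measure.pi_eq fun s hs => ?_
  rw [withDensity_apply _ (MeasurableSet.univ_pi hs),
    ← lintegral_indicator (MeasurableSet.univ_pi hs)]
  have : (Set.univ.pi s).indicator (fun x : Fin n → α => ∏ i, f (x i)) =
      fun x => ∏ i, (s i).indicator f (x i) := by
    ext x
    by_cases hx : x ∈ Set.univ.pi s
    · rw [Set.indicator_of_mem hx]
      exact Finset.prod_congr rfl fun i _ => (Set.indicator_of_mem (hx i trivial) f).symm
    · rw [Set.indicator_of_notMem hx]
      simp only [Set.mem_univ_pi, not_forall] at hx
      obtain ⟨i, hi⟩ := hx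
      exact (Finset.prod_eq_zero (Finset.mem_univ i) (Set.indicator_of_notMem hi f)).symm
  rw [this, lintegral_pi_fin_prod m (f := fun i => (s i).indicator f)
    (fun i => hf.indicator (hs i))]
  refine Finset.prod_congr rfl fun i _ => ?_
  rw [lintegral_indicator (hs i), withDensity_apply _ (hs i)]

/-- The law of a vector with i.i.d. `CN(0, v)` entries. -/
def gaussianVec (n : ℕ) (v : ℝ) : Measure (Vec n) :=
  (Measure.pi fun _ : Fin n => complexGaussian v).map (WithLp.toLp 2)

instance isProbabilityMeasure_gaussianVec (n : ℕ) (v : ℝ) :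
    IsProbabilityMeasure (gaussianVec n v) :=
  Measure.isProbabilityMeasure_map (by fun_prop)

theorem isRadialGaussian_gaussianVec (n : ℕ) {v : ℝ} (hv : 0 < v) :
    IsRadialGaussian (gaussianVec n v) v := by
  obtain ⟨H, hH, h⟩ := isRadialGaussian_complexGaussian hv
  have hσ : SigmaFinite (H.withDensity fun x : ℂ => ENNReal.ofReal (Real.exp (-(‖x‖ ^ 2 / v)))) := by
    rw [← h]; infer_instance
  refine ⟨(Measure.pi fun _ : Fin n => H).map (PiLp.continuousLinearEquiv 2 ℝ
    (fun _ : Fin n => ℂ)).symm, ContinuousLinearEquiv.isAddHaarMeasure_map _ _, ?_⟩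
  rw [gaussianVec, h, pi_withDensity H (by fun_prop)]
  have := map_withDensity_comp (m := Measure.pi fun _ : Fin n => H)
    (e := (WithLp.toLp 2 : (Fin n → ℂ) → Vec n)) (by fun_prop)
    (g := fun x : Vec n => ENNReal.ofReal (Real.exp (-(‖x‖ ^ 2 / v)))) (by fun_prop)
  refine Eq.trans ?_ this
  congr 2
  ext x
  rw [← ENNReal.ofReal_prod_of_nonneg (fun i _ => (Real.exp_pos _).le), ← Real.exp_sum,
    EuclideanSpace.norm_sq_eq, Finset.sum_neg_distrib, Finset.sum_div]

theorem IsIIDComplexGaussian.map_eq {Ω : Type*} [MeasurableSpace Ω] {μ : Measure Ω}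
    [IsProbabilityMeasure μ] {n : ℕ} {h : Ω → Vec n} {v : ℝ} (hh : IsIIDComplexGaussian μ h v)
    (hm : Measurable h) : μ.map h = gaussianVec n v := by
  have h1 := (iIndepFun_iff_map_fun_eq_pi_map (f := fun (i : Fin n) (ω : Ω) => h ω i)
    (fun i => by fun_prop)).1 hh.1
  simp_rw [fun i => (hh.2 i).map_eq] at h1
  rw [gaussianVec, ← h1, Measure.map_map (by fun_prop) (by fun_prop)]
  rfl

theorem finrank_real_vec (n : ℕ) : Module.finrank ℝ (Vec n) = 2 * n := by
  rw [← Module.finrank_mul_finrank ℝ ℂ (Vec n)]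
  simp

/-- For a unit vector `u`, the squared distance of a standard complex Gaussian vector to the line
spanned by `u` has a gamma distribution. -/
theorem map_residual_gaussianVec {n : ℕ} (hn : 0 < n) {u : Vec (n + 1)} (hu : ‖u‖ = 1) :
    (gaussianVec (n + 1) 1).map (fun h => ‖h‖ ^ 2 - ‖inner ℂ u h‖ ^ 2) = gammaMeasure n 1 := by
  -- In an orthonormal basis starting with `u`, the residual is the squared norm of the other `n`
  -- coordinates; only index `0` of the constant family is prescribed.
  obtain ⟨b, hb⟩ := Orthonormal.exists_orthonormalBasis_extension_of_card_eq (𝕜 := ℂ)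
    (E := Vec (n + 1)) (ι := Fin (n + 1)) (by simp) (v := fun _ => u) (s := {0}) (by
      constructor
      · rintro ⟨i, hi⟩; simpa using hu
      · rintro ⟨i, hi⟩ ⟨j, hj⟩ hij
        simp only [Set.mem_singleton_iff] at hi hj
        simp [hi, hj] at hij)
  have hb0 : b 0 = u := hb 0 rfl
  set e : Vec (n + 1) ≃ₗᵢ[ℝ] Vec (n + 1) :=
    { b.repr.toLinearEquiv.restrictScalars ℝ with norm_map' := b.repr.norm_map } with he
  have hmeas : Measurable fun y : Vec (n + 1) => ∑ i : Fin n, ‖y i.succ‖ ^ 2 := by fun_prop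
  have hfun : (fun h : Vec (n + 1) => ‖h‖ ^ 2 - ‖inner ℂ u h‖ ^ 2) =
      (fun y : Vec (n + 1) => ∑ i : Fin n, ‖y i.succ‖ ^ 2) ∘ e := by
    ext h
    have h1 : ‖h‖ ^ 2 = ∑ i, ‖b.repr h i‖ ^ 2 := by
      rw [← EuclideanSpace.norm_sq_eq, b.repr.norm_map]
    rw [h1, Fin.sum_univ_succ, b.repr_apply_apply, hb0]
    rw [add_sub_cancel_left]
    rfl
  have hrot : (gaussianVec (n + 1) 1).map e = gaussianVec (n + 1) 1 := by
    have : IsProbabilityMeasure ((gaussianVec (n + 1) 1).map e) :=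
      Measure.isProbabilityMeasure_map e.continuous.measurable.aemeasurable
    exact ((isRadialGaussian_gaussianVec (n + 1) one_pos).map e).eq
      (isRadialGaussian_gaussianVec (n + 1) one_pos)
  rw [hfun, ← Measure.map_map hmeas e.continuous.measurable, hrot]
  have hn' := (isRadialGaussian_gaussianVec n one_pos).map_norm_sq one_pos hn (finrank_real_vec n)
  rw [one_div_one] at hn'
  rw [← hn', gaussianVec, gaussianVec, Measure.map_map hmeas (by fun_prop),
    Measure.map_map (by fun_prop) (by fun_prop)]
  have hp := measurePreserving_piFinSuccAbove (fun _ : Fin (n + 1) => complexGaussian 1) 0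
  have hp2 : (Measure.pi fun _ : Fin n => complexGaussian 1) =
      (Measure.pi fun _ : Fin (n + 1) => complexGaussian 1).map
        (Prod.snd ∘ MeasurableEquiv.piFinSuccAbove (fun _ : Fin (n + 1) => ℂ) 0) := by
    rw [← Measure.map_map measurable_snd (MeasurableEquiv.measurable _), hp.map_eq,
      Measure.map_snd_prod]
    simp
  rw [hp2, Measure.map_map (by fun_prop) (measurable_snd.comp (MeasurableEquiv.measurable _))]
  congr 1
  ext x
  simp [EuclideanSpace.norm_sq_eq, MeasurableEquiv.piFinSuccAbove, Fin.tail]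

end ComplexGaussian

/-! ### Moments and tails of gamma and exponential laws -/

section GammaLaw

/-- Multiplying the density of shape `a` by `x` gives `a / r` times the density of shape `a + 1`,
which has mass one. -/
theorem lintegral_id_gammaMeasure {a r : ℝ} (ha : 0 < a) (hr : 0 < r) :
    ∫⁻ x, ENNReal.ofReal x ∂(gammaMeasure a r) = ENNReal.ofReal (a / r) := by
  have h1 := isProbabilityMeasure_gammaMeasure (show 0 < a + 1 by positivity) hr
  have h2 : ∫⁻ _, 1 ∂(gammaMeasure (a + 1) r) = 1 := by simp
  rw [lintegral_gammaMeasure measurable_const] at h2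
  rw [lintegral_gammaMeasure (by fun_prop), ← mul_one (ENNReal.ofReal (a / r)), ← h2,
    ← lintegral_const_mul _ (by
      have := (measurable_gammaPDFReal (a + 1) r).ennreal_ofReal
      exact this.mul measurable_const)]
  refine setLIntegral_congr_fun measurableSet_Ioi fun x hx => ?_
  have hx : 0 < x := hx
  have hG : 0 < Real.Gamma a := Real.Gamma_pos_of_pos ha
  rw [gammaPDF_of_nonneg hx.le, gammaPDF_of_nonneg hx.le, mul_one,
    ← ENNReal.ofReal_mul (by positivity), ← ENNReal.ofReal_mul (by positivity)]
  congr 1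
  rw [Real.Gamma_add_one ha.ne', Real.rpow_add_one hr.ne', add_sub_cancel_right,
    show x ^ a = x ^ (a - 1) * x by rw [← Real.rpow_add_one hx.ne', sub_add_cancel]]
  field_simp

theorem incGamma_nonneg (a : ℝ) {x : ℝ} (hx : 0 ≤ x) : 0 ≤ incGamma a x :=
  setIntegral_nonneg measurableSet_Ioi fun t ht => by
    have : 0 < t := hx.trans_lt ht
    positivity

theorem integrableOn_incGamma {a x : ℝ} (ha : 0 < a) (hx : 0 ≤ x) :
    IntegrableOn (fun t : ℝ => t ^ (a - 1) * Real.exp (-t)) (Set.Ioi x) := by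
  have := (Real.GammaIntegral_convergent ha).mono_set (Set.Ioi_subset_Ioi hx)
  simpa only [mul_comm] using this

theorem tendsto_incGamma {a : ℝ} (ha : 0 < a) {ι : Type*} {l : Filter ι}
    [l.IsCountablyGenerated] {u : ι → ℝ} (hu : Tendsto u l (𝓝 0)) (hu0 : ∀ᶠ i in l, 0 ≤ u i) :
    Tendsto (fun i => incGamma a (u i)) l (𝓝 (Real.Gamma a)) := by
  have h := (aecover_Ioi_of_Ioi (μ := volume) hu).integral_tendsto_of_countably_generated
    (integrableOn_incGamma ha le_rfl)
  have hG : Real.Gamma a = ∫ t in Set.Ioi (0 : ℝ), t ^ (a - 1) * Real.exp (-t) := by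
    rw [Real.Gamma_eq_integral ha]
    simp only [mul_comm]
  rw [hG]
  refine h.congr' ?_
  filter_upwards [hu0] with i hi
  rw [incGamma, Measure.restrict_restrict measurableSet_Ioi,
    Set.inter_eq_left.2 (Set.Ioi_subset_Ioi hi)]

/-- The power shifts the shape parameter to `a + b`. Used with `b = 0` for tails and with `b = -1`
for the mean of `1/g`, where `a + b = L - 2` is positive because `L ≥ 3`. -/
theorem setLIntegral_rpow_gammaMeasure {a b x : ℝ} (ha : 0 < a) (hab : 0 < a + b) (hx : 0 ≤ x) :
    ∫⁻ g in Set.Ioi x, ENNReal.ofReal (g ^ b) ∂(gammaMeasure a 1) =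
      ENNReal.ofReal (incGamma (a + b) x / Real.Gamma a) := by
  have hG : 0 < Real.Gamma a := Real.Gamma_pos_of_pos ha
  have hm : Measurable (gammaPDF a 1) := (measurable_gammaPDFReal a 1).ennreal_ofReal
  rw [gammaMeasure, setLIntegral_withDensity_eq_setLIntegral_mul _ hm (by fun_prop)
    measurableSet_Ioi, incGamma, ← integral_div, ofReal_integral_eq_lintegral_ofReal
      ((integrableOn_incGamma hab hx).div_const _)]
  · refine setLIntegral_congr_fun measurableSet_Ioi fun t ht => ?_
    have ht : 0 < t := hx.trans_lt ht
    rw [Pi.mul_apply, gammaPDF_of_nonneg ht.le, ← ENNReal.ofReal_mul (by positivity)]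
    congr 1
    rw [show a + b - 1 = (a - 1) + b by ring, Real.rpow_add ht, Real.one_rpow, one_mul]
    field_simp
  · filter_upwards [ae_restrict_mem measurableSet_Ioi] with t ht
    have ht : 0 < t := hx.trans_lt ht
    simp only [Pi.zero_apply]
    positivity

theorem gammaMeasure_Ioi {a x : ℝ} (ha : 0 < a) (hx : 0 ≤ x) :
    gammaMeasure a 1 (Set.Ioi x) = ENNReal.ofReal (incGamma a x / Real.Gamma a) := by
  have := setLIntegral_rpow_gammaMeasure (b := 0) ha (by simpa using ha) hx
  simpa using this

theorem gammaMeasure_Iic {a x : ℝ} (ha : 0 < a) (hx : 0 ≤ x) :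
    gammaMeasure a 1 (Set.Iic x) = ENNReal.ofReal (1 - incGamma a x / Real.Gamma a) := by
  have := isProbabilityMeasure_gammaMeasure ha one_pos
  have hG : 0 < Real.Gamma a := Real.Gamma_pos_of_pos ha
  rw [← Set.compl_Ioi, prob_compl_eq_one_sub measurableSet_Ioi, gammaMeasure_Ioi ha hx,
    ENNReal.ofReal_sub _ (div_nonneg (incGamma_nonneg a hx) hG.le), ENNReal.ofReal_one]

theorem gammaMeasure_singleton (a r x : ℝ) : gammaMeasure a r {x} = 0 :=
  withDensity_absolutelyContinuous _ _ (measure_singleton x)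

theorem incGamma_one (x : ℝ) : incGamma 1 x = Real.exp (-x) := by
  simp [incGamma, integral_exp_Iic]

theorem expMeasure_Ioi {x : ℝ} (hx : 0 ≤ x) :
    gammaMeasure 1 1 (Set.Ioi x) = ENNReal.ofReal (Real.exp (-x)) := by
  rw [gammaMeasure_Ioi one_pos hx, incGamma_one, Real.Gamma_one, div_one]

theorem expMeasure_Ici {x : ℝ} (hx : 0 ≤ x) :
    gammaMeasure 1 1 (Set.Ici x) = ENNReal.ofReal (Real.exp (-x)) := by
  rw [← expMeasure_Ioi hx, ← Set.Ioi_union_left]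
  refine le_antisymm ((measure_union_le _ _).trans ?_) (measure_mono Set.subset_union_left)
  rw [gammaMeasure_singleton, add_zero]

/-- The density decreases, so its value at the left endpoint dominates. This linearization makes the
bound depend on the interference gain only through its mean. -/
theorem expMeasure_Icc_le {x d : ℝ} (hx : 0 ≤ x) :
    gammaMeasure 1 1 (Set.Icc x (x + d)) ≤ ENNReal.ofReal (Real.exp (-x)) * ENNReal.ofReal d := by
  rw [gammaMeasure, withDensity_apply _ measurableSet_Icc]
  calc ∫⁻ t in Set.Icc x (x + d), gammaPDF 1 1 t
      ≤ ∫⁻ _ in Set.Icc x (x + d), ENNReal.ofReal (Real.exp (-x)) := by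
        refine setLIntegral_mono measurable_const fun t ht => ?_
        rw [gammaPDF_of_nonneg (hx.trans ht.1)]
        refine ENNReal.ofReal_le_ofReal ?_
        simpa using ht.1
    _ = _ := by rw [setLIntegral_const, Real.volume_Icc, add_sub_cancel_left]

theorem expMeasure_Ioc_ne_zero {x y : ℝ} (hx : 0 ≤ x) (hxy : x < y) :
    gammaMeasure 1 1 (Set.Ioc x y) ≠ 0 := by
  intro h
  have h1 : gammaMeasure 1 1 (Set.Ioi x) ≤ gammaMeasure 1 1 (Set.Ioi y) := by
    rw [← Set.Ioc_union_Ioi_eq_Ioi hxy.le]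
    refine (measure_union_le _ _).trans ?_
    rw [h, zero_add]
  rw [expMeasure_Ioi hx, expMeasure_Ioi (hx.trans hxy.le),
    ENNReal.ofReal_le_ofReal_iff (Real.exp_pos _).le, Real.exp_le_exp] at h1
  linarith

end GammaLaw

/-! ### The optimal orthogonal beamformer -/

section Beamformer

/-- Only the component `w` of `s` orthogonal to `u` is visible to admissible beamformers;
Cauchy–Schwarz bounds the gain by `P * ‖w‖ ^ 2`, and `w` rescaled to power `P` attains it. -/
theorem IsOCBeamformer.norm_inner_sq {L : ℕ} {u s f : Vec L} {P : ℝ} (hP : 0 ≤ P) (hu : ‖u‖ = 1)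
    (hf : IsOCBeamformer u s P f) :
    ‖inner ℂ f s‖ ^ 2 = P * (‖s‖ ^ 2 - ‖inner ℂ u s‖ ^ 2) := by
  set w : Vec L := s - (inner ℂ u s : ℂ) • u with hw
  have huu : inner ℂ u u = (1 : ℂ) := by rw [inner_self_eq_norm_sq_to_K, hu]; simp
  have huw : inner ℂ u w = (0 : ℂ) := by
    rw [hw, inner_sub_right, inner_smul_right, huu, mul_one, sub_self]
  have hwu : inner ℂ w u = (0 : ℂ) := by rw [← inner_conj_symm, huw, map_zero]
  have hs : s = w + (inner ℂ u s : ℂ) • u := by rw [hw, sub_add_cancel]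
  have hws : inner ℂ w s = ((‖w‖ ^ 2 : ℝ) : ℂ) := by
    conv_lhs => rw [hs]
    rw [inner_add_right, inner_smul_right, hwu, mul_zero, add_zero, inner_self_eq_norm_sq_to_K]
    simp
  have hnorm : ‖w‖ ^ 2 = ‖s‖ ^ 2 - ‖inner ℂ u s‖ ^ 2 := by
    have h1 : ‖s‖ * ‖s‖ = ‖w‖ * ‖w‖ + ‖(inner ℂ u s : ℂ) • u‖ * ‖(inner ℂ u s : ℂ) • u‖ := by
      conv_lhs => rw [hs]
      exact norm_add_sq_eq_norm_sq_add_norm_sq_of_inner_eq_zero _ _ (by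
        rw [inner_smul_right, hwu, mul_zero])
    rw [norm_smul, hu, mul_one] at h1
    linarith
  rw [← hnorm]
  apply le_antisymm
  · have h1 : inner ℂ f s = inner ℂ f w := by
      conv_lhs => rw [hs]
      rw [inner_add_right, inner_smul_right, hf.orthogonal, mul_zero, add_zero]
    rw [h1]
    calc ‖inner ℂ f w‖ ^ 2 ≤ (‖f‖ * ‖w‖) ^ 2 := by gcongr; exact norm_inner_le_norm f w
      _ = ‖f‖ ^ 2 * ‖w‖ ^ 2 := mul_pow _ _ _
      _ ≤ P * ‖w‖ ^ 2 := by gcongr; exact hf.power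
  · rcases eq_or_ne w 0 with h0 | h0
    · rw [h0]; simp
    · have hwpos : 0 < ‖w‖ := norm_pos_iff.2 h0
      set c : ℝ := √P / ‖w‖ with hc
      have hc0 : 0 ≤ c := by positivity
      have h1 := hf.optimal ((c : ℂ) • w) (by rw [inner_smul_left, hwu, mul_zero]) (by
        rw [norm_smul, Complex.norm_real, Real.norm_of_nonneg hc0, hc,
          div_mul_cancel₀ _ hwpos.ne', Real.sq_sqrt hP])
      refine le_trans (le_of_eq ?_) h1
      rw [inner_smul_left, hws, norm_mul, Complex.conj_ofReal, Complex.norm_real,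
        Complex.norm_real, Real.norm_of_nonneg hc0, Real.norm_of_nonneg (by positivity), mul_pow, hc,
        div_pow, Real.sq_sqrt hP]
      field_simp

theorem norm_sq_mul_shape {L : ℕ} (u h : Vec L) :
    ‖h‖ ^ 2 * (‖shape h‖ ^ 2 - ‖inner ℂ u (shape h)‖ ^ 2) = ‖h‖ ^ 2 - ‖inner ℂ u h‖ ^ 2 := by
  rcases eq_or_ne h 0 with rfl | h0
  · simp
  · have : 0 < ‖h‖ := norm_pos_iff.2 h0
    rw [shape, inner_smul_right, norm_smul, norm_mul, Complex.norm_real,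
      Real.norm_of_nonneg (by positivity)]
    field_simp

end Beamformer

/-! ### Rounding down to the codebook -/

section Codebook

variable {A : ℕ} {p : ℕ → ℝ}

theorem le_codebookFloor {x : ℝ} {k : ℕ} (hk : k < 2 ^ A) (hx : p k ≤ x) :
    p k ≤ Channel.codebookFloor A p x :=
  le_csSup ⟨x, fun _ hy => hy.2⟩ ⟨⟨k, hk, rfl⟩, hx⟩

theorem codebook_nonneg (h0 : p 0 = 0) (hp : StrictMonoOn p (Set.Iio (2 ^ A))) {k : ℕ}
    (hk : k < 2 ^ A) : 0 ≤ p k := by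
  rw [← h0]
  exact hp.monotoneOn (Set.mem_Iio.2 (by positivity)) hk (Nat.zero_le k)

theorem codebookFloor_nonneg (h0 : p 0 = 0) (hp : StrictMonoOn p (Set.Iio (2 ^ A))) (x : ℝ) :
    0 ≤ Channel.codebookFloor A p x := by
  refine Real.sSup_nonneg ?_
  rintro _ ⟨⟨k, hk, rfl⟩, -⟩
  exact codebook_nonneg h0 hp hk

theorem monotone_codebookFloor (h0 : p 0 = 0) (hp : StrictMonoOn p (Set.Iio (2 ^ A))) :
    Monotone (Channel.codebookFloor A p) := by
  intro x y hxy
  rcases lt_or_ge x 0 with hx | hx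
  -- Below the smallest codeword the set is empty and `sSup ∅ = 0`, which keeps the floor monotone
  -- on the whole line and hence measurable.
  · have : p '' Set.Iio (2 ^ A) ∩ Set.Iic x = ∅ := by
      rw [Set.eq_empty_iff_forall_notMem]
      rintro _ ⟨⟨k, hk, rfl⟩, hkx⟩
      exact absurd (codebook_nonneg h0 hp hk) (not_le.2 (lt_of_le_of_lt hkx hx))
    rw [Channel.codebookFloor, this, Real.sSup_empty]
    exact codebookFloor_nonneg h0 hp y
  · refine csSup_le_csSup ⟨y, fun _ hz => hz.2⟩ ?_
      (Set.inter_subset_inter_right _ (Set.Iic_subset_Iic.2 hxy))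
    exact ⟨p 0, ⟨0, Set.mem_Iio.2 (by positivity), rfl⟩, h0.trans_le hx⟩

theorem codebookFloor_congr {p' : ℕ → ℝ} (h : ∀ k < 2 ^ A, p k = p' k) (x : ℝ) :
    Channel.codebookFloor A p x = Channel.codebookFloor A p' x := by
  have : p '' Set.Iio (2 ^ A) = p' '' Set.Iio (2 ^ A) := Set.image_congr fun k hk => h k hk
  rw [Channel.codebookFloor, Channel.codebookFloor, this]

/-- Rounding down to the codebook moves a value across `t` only inside a single cell. -/
theorem exists_cell_of_codebookFloor_le (h0 : p 0 = 0) {t : ℝ} (ht : 0 ≤ t) :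
    ∃ k < 2 ^ A, ∀ x, Channel.codebookFloor A p x ≤ t →
      x ≤ t ∨ (p k < x ∧ (k + 1 < 2 ^ A → x ≤ p (k + 1))) := by
  classical
  have hA : 0 < 2 ^ A := by positivity
  -- The last codeword index not above `t`. If `x` exceeded `p (k + 1)`, its floor would be at least
  -- `p (k + 1)`, forcing `p (k + 1) ≤ t`; the last cell has no upper end.
  set k := Nat.findGreatest (fun k => p k ≤ t) (2 ^ A - 1) with hk
  have hkt : p k ≤ t :=
    Nat.findGreatest_spec (P := fun k => p k ≤ t) (Nat.zero_le _) (h0.trans_le ht)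
  have hkA : k ≤ 2 ^ A - 1 := Nat.findGreatest_le _
  refine ⟨k, by omega, fun x hx => ?_⟩
  rcases le_or_gt x t with hxt | hxt
  · exact Or.inl hxt
  · refine Or.inr ⟨hkt.trans_lt hxt, fun hk1 => ?_⟩
    by_contra! hlt
    have h1 : p (k + 1) ≤ t := (le_codebookFloor hk1 hlt.le).trans hx
    have h2 := Nat.le_findGreatest (P := fun k => p k ≤ t) (n := 2 ^ A - 1) (m := k + 1)
      (by omega) h1
    omega

end Codebook

/-! ### Quantization error and mean interference gain -/

namespace Params

variable (S : Params)

theorem L_sub_one_pos : (0 : ℝ) < (S.L : ℝ) - 1 := by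
  have : (1 : ℝ) < S.L := by exact_mod_cast S.one_lt_L
  linarith

/-- The smallest primary channel gain `θ_p / γ_p` that avoids a primary outage. -/
def gainThreshold : ℝ := S.thetaP / S.gammaP

theorem gainThreshold_pos : 0 < S.gainThreshold := div_pos S.thetaP_pos S.gammaP_pos

/-- The largest possible CDI quantization error. -/
def maxQuantError : ℝ := (2 : ℝ) ^ (-((S.B : ℝ) / ((S.L : ℝ) - 1)))

theorem maxQuantError_pos : 0 < S.maxQuantError := Real.rpow_pos_of_pos two_pos _

theorem two_pow_mul_maxQuantError_pow : (2 : ℝ) ^ S.B * S.maxQuantError ^ (S.L - 1) = 1 := by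
  have h1 : ((S.L - 1 : ℕ) : ℝ) = (S.L : ℝ) - 1 := by
    rw [Nat.cast_sub S.one_lt_L.le, Nat.cast_one]
  rw [maxQuantError, ← Real.rpow_natCast _ (S.L - 1), ← Real.rpow_mul two_pos.le, h1, neg_mul,
    div_mul_cancel₀ _ S.L_sub_one_pos.ne', Real.rpow_neg two_pos.le, Real.rpow_natCast,
    mul_inv_cancel₀ (by positivity)]

end Params

namespace Channel

variable {S : Params} {Ω : Type*} [MeasurableSpace Ω] {μ : Measure Ω}
  {V : Type*} [MeasurableSpace V] (C : Channel S μ V)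

theorem _root_.CognitiveBeamforming.measurable_shape {L : ℕ} :
    Measurable (shape : Vec L → Vec L) := by
  unfold shape
  fun_prop

theorem _root_.CognitiveBeamforming.measurable_quantError {L : ℕ} {α : Type*} [MeasurableSpace α]
    {f g : α → Vec L} (hf : Measurable f) (hg : Measurable g) :
    Measurable fun a => quantError (f a) (g a) := by
  unfold quantError
  fun_prop

theorem measurable_gp : Measurable C.gp := (C.measurable_hp.norm).pow_const 2

theorem measurable_gx : Measurable C.gx := ((C.measurable_hx.norm).pow_const 2).div_const _

theorem measurable_sx : Measurable C.sx := measurable_shape.comp C.measurable_hx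

theorem measurable_sxhat : Measurable C.sxhat :=
  C.measurable_quantizer.comp (C.measurable_sx.prodMk C.measurable_seed)

theorem measurable_eps : Measurable C.eps :=
  measurable_quantError C.measurable_sxhat C.measurable_sx

/-- Interference gain `λ g_x ε` of an orthogonal beamformer at the primary receiver. -/
def interferenceGain (ω : Ω) : ℝ := S.lam * C.gx ω * C.eps ω

theorem measurable_interferenceGain : Measurable C.interferenceGain :=
  (C.measurable_gx.const_mul _).mul C.measurable_eps

theorem interferenceGain_eq (ω : Ω) : C.interferenceGain ω = ‖C.hx ω‖ ^ 2 * C.eps ω := by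
  rw [interferenceGain, gx, mul_div_cancel₀ _ S.lam_pos.ne']

/-- Squared length of the secondary channel orthogonally to the quantized CDI. -/
def residualGain (ω : Ω) : ℝ := ‖C.hs ω‖ ^ 2 - ‖inner ℂ (C.sxhat ω) (C.hs ω)‖ ^ 2

theorem measurable_residualGain : Measurable C.residualGain := by
  have h1 := C.measurable_hs
  have h2 := C.measurable_sxhat
  unfold residualGain
  fun_prop

theorem map_gp : μ.map C.gp = gammaMeasure 1 1 := by
  have h := (isRadialGaussian_complexGaussian one_pos).map_norm_sq one_pos one_pos
    (by rw [Complex.finrank_real_complex, mul_one])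
  rw [← C.law_hp.map_eq, Measure.map_map (by fun_prop) C.measurable_hp] at h
  rw [Nat.cast_one, one_div_one] at h
  exact h

variable [IsProbabilityMeasure μ]

theorem measure_eps_le {τ : ℝ} (h0 : 0 ≤ τ) (h1 : τ ≤ S.maxQuantError) :
    μ {ω | C.eps ω ≤ τ} = ENNReal.ofReal ((2 : ℝ) ^ S.B * τ ^ (S.L - 1)) := by
  rw [← C.quantError_cdf τ h0 h1, measureReal_def, ENNReal.ofReal_toReal (measure_ne_top _ _)]
  rfl

theorem ae_eps_pos : ∀ᵐ ω ∂μ, 0 < C.eps ω := by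
  have h := C.measure_eps_le le_rfl S.maxQuantError_pos.le
  rw [zero_pow (by have := S.one_lt_L; omega), mul_zero, ENNReal.ofReal_zero] at h
  rw [ae_iff]
  simpa only [not_lt] using h

theorem measure_lt_eps {τ : ℝ} (h0 : 0 ≤ τ) :
    μ {ω | τ < C.eps ω} = ENNReal.ofReal (1 - (2 : ℝ) ^ S.B * (min τ S.maxQuantError) ^ (S.L - 1)) := by
  have hc : ∀ τ : ℝ, μ {ω | τ < C.eps ω} = 1 - μ {ω | C.eps ω ≤ τ} := fun τ => by
    rw [← prob_compl_eq_one_sub (measurableSet_le C.measurable_eps measurable_const)]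
    congr 1
    ext ω
    simp
  rcases le_total τ S.maxQuantError with h1 | h1
  · rw [min_eq_left h1, hc, C.measure_eps_le h0 h1, ENNReal.ofReal_sub _ (by positivity),
      ENNReal.ofReal_one]
  · rw [min_eq_right h1, S.two_pow_mul_maxQuantError_pow, sub_self, ENNReal.ofReal_zero]
    have h2 : μ {ω | S.maxQuantError < C.eps ω} = 0 := by
      rw [hc, C.measure_eps_le S.maxQuantError_pos.le le_rfl, S.two_pow_mul_maxQuantError_pow]
      simp
    exact measure_mono_null (fun ω (hω : τ < C.eps ω) => h1.trans_lt hω) h2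

/-- Layer cake: the tail `1 - 2^B t^(L-1)` is integrated up to `T`, the maximal error, giving `T - T
/ L` because `2^B T^(L-1) = 1`. -/
theorem lintegral_eps :
    ∫⁻ ω, ENNReal.ofReal (C.eps ω) ∂μ =
      ENNReal.ofReal (((S.L : ℝ) - 1) / S.L * S.maxQuantError) := by
  set T := S.maxQuantError with hT
  have hT0 : 0 < T := S.maxQuantError_pos
  obtain ⟨m, hm⟩ : ∃ m, S.L = m + 2 := ⟨S.L - 2, by have := S.one_lt_L; omega⟩
  have hTp := S.two_pow_mul_maxQuantError_pow
  rw [← hT] at hTp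
  rw [lintegral_eq_lintegral_meas_lt μ (C.ae_eps_pos.mono fun _ h => h.le)
    C.measurable_eps.aemeasurable]
  calc ∫⁻ t in Set.Ioi (0 : ℝ), μ {ω | t < C.eps ω}
      = ∫⁻ t in Set.Ioi (0 : ℝ), ENNReal.ofReal
          (1 - (2 : ℝ) ^ S.B * (min t T) ^ (S.L - 1)) :=
        setLIntegral_congr_fun measurableSet_Ioi fun t ht => C.measure_lt_eps (le_of_lt ht)
    _ = ∫⁻ t in Set.Ioc (0 : ℝ) T, ENNReal.ofReal (1 - (2 : ℝ) ^ S.B * t ^ (S.L - 1)) := by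
        rw [← Set.Ioc_union_Ioi_eq_Ioi hT0.le,
          lintegral_union measurableSet_Ioi (Set.Ioc_disjoint_Ioi le_rfl)]
        rw [setLIntegral_congr_fun (s := Set.Ioi T) measurableSet_Ioi (g := fun _ => 0)]
        · rw [lintegral_zero, add_zero]
          refine setLIntegral_congr_fun measurableSet_Ioc fun t ht => ?_
          simp only [min_eq_left ht.2]
        · intro t ht
          simp only [min_eq_right (le_of_lt (Set.mem_Ioi.1 ht)), hTp, sub_self,
            ENNReal.ofReal_zero]
    _ = ENNReal.ofReal (∫ t in (0 : ℝ)..T, (1 - (2 : ℝ) ^ S.B * t ^ (S.L - 1))) := by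
        rw [intervalIntegral.integral_of_le hT0.le, ofReal_integral_eq_lintegral_ofReal]
        · exact (Continuous.integrableOn_Ioc (by fun_prop))
        · filter_upwards [ae_restrict_mem measurableSet_Ioc] with t ht
          have : t ^ (S.L - 1) ≤ T ^ (S.L - 1) := pow_le_pow_left₀ ht.1.le ht.2 _
          simp only [Pi.zero_apply, sub_nonneg]
          rw [← hTp]
          gcongr
    _ = _ := by
        congr 1
        rw [intervalIntegral.integral_sub (by simp) (Continuous.intervalIntegrable (by fun_prop) _ _),
          intervalIntegral.integral_const_mul, integral_pow]
        rw [hm] at hTp ⊢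
        simp only [intervalIntegral.integral_const, show m + 2 - 1 = m + 1 by omega] at hTp ⊢
        have : (2 : ℝ) ^ S.B * T ^ (m + 1 + 1) = T := by rw [pow_succ, ← mul_assoc, hTp, one_mul]
        push_cast
        rw [zero_pow (by omega), sub_zero, sub_zero, ← mul_div_assoc, this]
        have h2 : (m : ℝ) + 1 + 1 ≠ 0 := by positivity
        have h3 : (m : ℝ) + 2 ≠ 0 := by positivity
        simp only [smul_eq_mul, mul_one]
        field_simp
        ring

theorem map_hx_seed : μ.map (fun ω => (C.seed ω, C.hx ω)) =
    (μ.map C.seed).prod (gaussianVec S.L S.lam) := by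
  rw [(indepFun_iff_map_prod_eq_prod_map_map C.measurable_seed.aemeasurable
    C.measurable_hx.aemeasurable).1 C.indep_hx.symm, C.law_hx.map_eq C.measurable_hx]

/-- For a fixed seed, `ε` depends on `h_x` only through its direction, hence is independent of
`‖h_x‖²`. The mean is the product of `λ L` and `(L-1)/L` times the maximal error. -/
theorem lintegral_interferenceGain :
    ∫⁻ ω, ENNReal.ofReal (C.interferenceGain ω) ∂μ =
      ENNReal.ofReal (S.lam * ((S.L : ℝ) - 1) * S.maxQuantError) := by
  have hL : 0 < S.L := by have := S.one_lt_L; omega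
  have hL' : (0 : ℝ) < S.L := by exact_mod_cast hL
  have hm1 := C.measurable_quantizer
  have hm3 := measurable_shape (L := S.L)
  have hmφ : Measurable fun q : V × Vec S.L =>
      ENNReal.ofReal (quantError (C.quantizer (q.2, q.1)) q.2) :=
    (measurable_quantError (hm1.comp measurable_swap) measurable_snd).ennreal_ofReal
  have hmφ' : Measurable fun q : V × Vec S.L =>
      ENNReal.ofReal (quantError (C.quantizer (shape q.2, q.1)) (shape q.2)) :=
    (measurable_quantError (hm1.comp ((hm3.comp measurable_snd).prodMk measurable_fst))
      (hm3.comp measurable_snd)).ennreal_ofReal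
  have hshape : ∀ x : Vec S.L, shape x = ‖x‖⁻¹ • x := fun x => by
    rw [shape]; exact Complex.coe_smul _ _
  have hmsx := C.measurable_seed.prodMk C.measurable_hx
  have h1 : ∫⁻ ω, ENNReal.ofReal (C.eps ω) ∂μ = ∫⁻ s, ∫⁻ x,
      ENNReal.ofReal (quantError (C.quantizer (shape x, s)) (shape x))
      ∂(gaussianVec S.L S.lam) ∂(μ.map C.seed) := by
    rw [← lintegral_prod _ hmφ'.aemeasurable, ← C.map_hx_seed, lintegral_map hmφ' hmsx]
    rfl
  have hmul : Measurable fun q : V × Vec S.L => ENNReal.ofReal (‖q.2‖ ^ 2) *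
      ENNReal.ofReal (quantError (C.quantizer (shape q.2, q.1)) (shape q.2)) :=
    (by fun_prop : Measurable fun q : V × Vec S.L => ENNReal.ofReal (‖q.2‖ ^ 2)).mul hmφ'
  have h2 : ∫⁻ ω, ENNReal.ofReal (C.interferenceGain ω) ∂μ = ∫⁻ s, ∫⁻ x, ENNReal.ofReal (‖x‖ ^ 2) *
      ENNReal.ofReal (quantError (C.quantizer (shape x, s)) (shape x))
      ∂(gaussianVec S.L S.lam) ∂(μ.map C.seed) := by
    rw [← lintegral_prod _ hmul.aemeasurable, ← C.map_hx_seed, lintegral_map hmul hmsx]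
    refine lintegral_congr fun ω => ?_
    rw [C.interferenceGain_eq, ENNReal.ofReal_mul (by positivity)]
    rfl
  have h3 : ∀ s : V, ∫⁻ x, ENNReal.ofReal (‖x‖ ^ 2) *
      ENNReal.ofReal (quantError (C.quantizer (shape x, s)) (shape x)) ∂(gaussianVec S.L S.lam) =
      ENNReal.ofReal (S.lam * S.L) *
        ∫⁻ x, ENNReal.ofReal (quantError (C.quantizer (shape x, s)) (shape x))
          ∂(gaussianVec S.L S.lam) := fun s => by
    have := (isRadialGaussian_gaussianVec S.L S.lam_pos).lintegral_eq S.lam_pos hL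
      (finrank_real_vec S.L) (f := ENNReal.ofReal) ENNReal.measurable_ofReal
      (φ := fun x => ENNReal.ofReal (quantError (C.quantizer (x, s)) x))
      (measurable_quantError (hm1.comp (measurable_id.prodMk measurable_const))
        measurable_id).ennreal_ofReal
    simp only [hshape]
    rw [this, lintegral_id_gammaMeasure hL' (one_div_pos.2 S.lam_pos)]
    congr 2
    rw [div_div_eq_mul_div, div_one, mul_comm]
  rw [h2]
  simp_rw [h3]
  rw [lintegral_const_mul _ hmφ'.lintegral_prod_right', ← h1, C.lintegral_eps,
    ← ENNReal.ofReal_mul (mul_nonneg S.lam_pos.le hL'.le)]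
  congr 1
  field_simp

theorem ae_interferenceGain_pos : ∀ᵐ ω ∂μ, 0 < C.interferenceGain ω := by
  have hL : 0 < S.L := by have := S.one_lt_L; omega
  have : Nontrivial (Vec S.L) :=
    Module.nontrivial_of_finrank_pos (R := ℝ) (by rw [finrank_real_vec]; omega)
  have h0 : ∀ᵐ ω ∂μ, C.hx ω ≠ 0 := by
    have h := (isRadialGaussian_gaussianVec S.L S.lam_pos).measure_singleton_zero
    rw [← C.law_hx.map_eq C.measurable_hx, Measure.map_apply C.measurable_hx
      (measurableSet_singleton 0)] at h
    rw [ae_iff]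
    simp only [ne_eq, not_not]
    exact h
  filter_upwards [h0, C.ae_eps_pos] with ω h1 h2
  rw [C.interferenceGain_eq]
  have := norm_pos_iff.2 h1
  positivity

end Channel

/-! ### The IPC signal as a function of interference and primary gains -/

namespace Params

variable (S : Params)

/-- Interference margin as a function of the primary channel gain. -/
def marginOf (g : ℝ) : ℝ := S.sigma2 * (S.gammaP * g / S.thetaP - 1)

open Classical in
/-- Unquantized IPC signal as a function of the interference gain and the primary gain. -/
def etaOf (Pmax : ℝ) (q : ℝ × ℝ) : ℝ :=
  if 0 ≤ S.marginOf q.2 then S.marginOf q.2 / q.1 else Pmax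

open Classical in
/-- Quantized IPC signal as a function of the interference gain and the primary gain. -/
def etahatOf (Pmax : ℝ) (p : ℕ → ℝ) (q : ℝ × ℝ) : ℝ :=
  if 0 ≤ S.marginOf q.2 ∧ S.etaOf Pmax q < Pmax then
    Channel.codebookFloor S.A p (S.etaOf Pmax q) else Pmax

@[fun_prop]
theorem measurable_marginOf : Measurable S.marginOf := by
  unfold marginOf
  fun_prop

theorem measurable_etaOf (Pmax : ℝ) : Measurable (S.etaOf Pmax) :=
  Measurable.ite (measurableSet_le measurable_const (by fun_prop)) (by fun_prop) measurable_const

theorem measurable_etahatOf (Pmax : ℝ) {p : ℕ → ℝ} (h0 : p 0 = 0)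
    (hp : StrictMonoOn p (Set.Iio (2 ^ S.A))) : Measurable (S.etahatOf Pmax p) :=
  Measurable.ite ((measurableSet_le (f := fun _ : ℝ × ℝ => (0 : ℝ))
      (g := fun q => S.marginOf q.2) measurable_const (by fun_prop)).inter
      (measurableSet_lt (S.measurable_etaOf Pmax) measurable_const))
    ((monotone_codebookFloor h0 hp).measurable.comp (S.measurable_etaOf Pmax)) measurable_const

theorem marginOf_nonneg_iff {g : ℝ} : 0 ≤ S.marginOf g ↔ S.gainThreshold ≤ g := by
  rw [marginOf, mul_nonneg_iff_of_pos_left S.sigma2_pos, sub_nonneg, le_div_iff₀ S.thetaP_pos,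
    one_mul, gainThreshold, div_le_iff₀' S.gammaP_pos]

/-- Turns a threshold on `η` into one on the primary gain that is affine in the interference gain,
ready for the exponential law. -/
theorem lt_marginOf_div_iff {w g s : ℝ} (hw : 0 < w) :
    s < S.marginOf g / w ↔ S.gainThreshold + S.gainThreshold / S.sigma2 * s * w < g := by
  have h1 := S.gammaP_pos
  have h2 := S.thetaP_pos
  have h3 := S.sigma2_pos
  rw [lt_div_iff₀ hw, marginOf, gainThreshold,
    show S.sigma2 * (S.gammaP * g / S.thetaP - 1) =
      S.sigma2 * S.gammaP / S.thetaP * g - S.sigma2 by ring, lt_sub_iff_add_lt,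
    show s * w + S.sigma2 = S.sigma2 * S.gammaP / S.thetaP *
      (S.thetaP / S.gammaP + S.thetaP / S.gammaP / S.sigma2 * s * w) by field_simp; ring]
  exact mul_lt_mul_iff_right₀ (by positivity)

end Params

/-! ### Joint law of the gains and distribution of the IPC signal -/

namespace Channel

variable {S : Params} {Ω : Type*} [MeasurableSpace Ω] {μ : Measure Ω}
  {V : Type*} [MeasurableSpace V] (C : Channel S μ V)

theorem measurable_eta (Pmax : ℝ) : Measurable (C.eta Pmax) :=
  (S.measurable_etaOf Pmax).comp (C.measurable_interferenceGain.prodMk C.measurable_gp)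

theorem measurable_etahat (Pmax : ℝ) {p : ℕ → ℝ} (hp : C.IsCodebook Pmax p) :
    Measurable (C.etahat Pmax p) :=
  (S.measurable_etahatOf Pmax hp.zero hp.strictMono).comp
    (C.measurable_interferenceGain.prodMk C.measurable_gp)

theorem etahat_nonneg {Pmax : ℝ} (hP : 0 < Pmax) {p : ℕ → ℝ} (hp : C.IsCodebook Pmax p) (ω : Ω) :
    0 ≤ C.etahat Pmax p ω := by
  rw [etahat]
  split_ifs
  · exact codebookFloor_nonneg hp.zero hp.strictMono _
  · exact hP.le

theorem mem_noPrimaryOutage {ω : Ω} : ω ∈ C.noPrimaryOutage ↔ S.gainThreshold ≤ C.gp ω := by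
  rw [Params.gainThreshold, div_le_iff₀' S.gammaP_pos]
  rfl

theorem margin_nonneg_iff {ω : Ω} : 0 ≤ C.margin ω ↔ ω ∈ C.noPrimaryOutage := by
  rw [mem_noPrimaryOutage]
  exact S.marginOf_nonneg_iff

theorem eta_of_mem {ω : Ω} (h : ω ∈ C.noPrimaryOutage) (Pmax : ℝ) :
    C.eta Pmax ω = S.marginOf (C.gp ω) / C.interferenceGain ω :=
  if_pos (C.margin_nonneg_iff.2 h)

theorem measurableSet_noPrimaryOutage : MeasurableSet C.noPrimaryOutage := by
  have : C.noPrimaryOutage = {ω | S.gainThreshold ≤ C.gp ω} := by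
    ext ω
    exact C.mem_noPrimaryOutage
  rw [this]
  exact measurableSet_le measurable_const C.measurable_gp

theorem measure_noPrimaryOutage :
    μ C.noPrimaryOutage = ENNReal.ofReal (Real.exp (-S.gainThreshold)) := by
  rw [← expMeasure_Ici S.gainThreshold_pos.le, ← C.map_gp,
    Measure.map_apply C.measurable_gp measurableSet_Ici]
  congr 1
  ext ω
  exact C.mem_noPrimaryOutage

variable [IsProbabilityMeasure μ]

theorem map_interferenceGain_gp : μ.map (fun ω => (C.interferenceGain ω, C.gp ω)) =
    (μ.map C.interferenceGain).prod (gammaMeasure 1 1) := by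
  have hψ : Measurable fun d : Vec S.L × V => S.lam * (‖d.1‖ ^ 2 / S.lam) *
      quantError (C.quantizer (shape d.1, d.2)) (shape d.1) := by
    have h : Measurable fun d : Vec S.L × V => shape d.1 := measurable_shape.comp measurable_fst
    exact (by fun_prop : Measurable fun d : Vec S.L × V => S.lam * (‖d.1‖ ^ 2 / S.lam)).mul
      (measurable_quantError (C.measurable_quantizer.comp (h.prodMk measurable_snd)) h)
  have hind : IndepFun C.interferenceGain C.gp μ :=
    (C.indep_hp.comp (by fun_prop : Measurable fun z : ℂ => ‖z‖ ^ 2) hψ).symm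
  rw [(indepFun_iff_map_prod_eq_prod_map_map C.measurable_interferenceGain.aemeasurable
    C.measurable_gp.aemeasurable).1 hind, C.map_gp]

/-- Given `(h_p, h_x, seed)` the quantized CDI is a fixed unit vector, and the law of the residual
is the same for every unit vector. The residual is therefore independent of those data. -/
theorem map_residualGain_prod : μ.map (fun ω => (C.residualGain ω,
      (C.interferenceGain ω, C.gp ω))) =
    (gammaMeasure ((S.L : ℝ) - 1) 1).prod (μ.map fun ω => (C.interferenceGain ω, C.gp ω)) := by
  have hres : ∀ {L : ℕ}, 1 < L → ∀ u : Vec L, ‖u‖ = 1 →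
      (gaussianVec L 1).map (fun h => ‖h‖ ^ 2 - ‖inner ℂ u h‖ ^ 2) =
        gammaMeasure ((L : ℝ) - 1) 1 := by
    intro L hL u hu
    obtain ⟨n, rfl⟩ : ∃ n, L = n + 1 := ⟨L - 1, by omega⟩
    rw [map_residual_gaussianVec (by omega) hu]
    simp
  have hγ := isProbabilityMeasure_gammaMeasure S.L_sub_one_pos one_pos
  set D : Ω → ℂ × Vec S.L × V := fun ω => (C.hp ω, C.hx ω, C.seed ω) with hD
  have hDm : Measurable D :=
    C.measurable_hp.prodMk (C.measurable_hx.prodMk C.measurable_seed)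
  set u : ℂ × Vec S.L × V → Vec S.L := fun d => C.quantizer (shape d.2.1, d.2.2) with hu
  have hsh : Measurable fun d : ℂ × Vec S.L × V => shape d.2.1 :=
    measurable_shape.comp (measurable_fst.comp measurable_snd)
  have hum : Measurable u :=
    C.measurable_quantizer.comp (hsh.prodMk (measurable_snd.comp measurable_snd))
  -- `λ` is left uncancelled so that `ψ (D ω)` is definitionally the pair of interference and
  -- primary gains.
  set ψ : ℂ × Vec S.L × V → ℝ × ℝ := fun d => (S.lam * (‖d.2.1‖ ^ 2 / S.lam) *
      quantError (u d) (shape d.2.1), ‖d.1‖ ^ 2) with hψ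
  have hψm : Measurable ψ :=
    ((by fun_prop : Measurable fun d : ℂ × Vec S.L × V => S.lam * (‖d.2.1‖ ^ 2 / S.lam)).mul
      (measurable_quantError hum hsh)).prodMk (by fun_prop)
  have hjoint : μ.map (fun ω => (D ω, C.hs ω)) = (μ.map D).prod (gaussianVec S.L 1) := by
    rw [(indepFun_iff_map_prod_eq_prod_map_map hDm.aemeasurable
      C.measurable_hs.aemeasurable).1 C.indep_hs.symm, C.law_hs.map_eq C.measurable_hs]
  have huD : ∀ᵐ d ∂(μ.map D), ‖u d‖ = 1 := by
    rw [ae_map_iff hDm.aemeasurable (measurableSet_eq_fun hum.norm measurable_const)]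
    exact C.norm_quantizer
  have hm := C.measurable_interferenceGain.prodMk C.measurable_gp
  have hmr : Measurable fun q : (ℂ × Vec S.L × V) × Vec S.L =>
      ‖q.2‖ ^ 2 - ‖inner ℂ (u q.1) q.2‖ ^ 2 := by
    have h2 : Measurable fun q : (ℂ × Vec S.L × V) × Vec S.L => (inner ℂ (u q.1) q.2 : ℂ) :=
      (hum.comp measurable_fst).inner measurable_snd
    fun_prop
  refine (Measure.prod_eq fun s t hs ht => ?_).symm
  have hset : MeasurableSet {q : (ℂ × Vec S.L × V) × Vec S.L |
      ‖q.2‖ ^ 2 - ‖inner ℂ (u q.1) q.2‖ ^ 2 ∈ s ∧ ψ q.1 ∈ t} :=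
    (hmr hs).inter ((hψm.comp measurable_fst) ht)
  rw [Measure.map_apply (C.measurable_residualGain.prodMk hm) (hs.prod ht),
    Measure.map_apply hm ht]
  have h1 : (fun ω => (C.residualGain ω, (C.interferenceGain ω, C.gp ω))) ⁻¹' s ×ˢ t =
      (fun ω => (D ω, C.hs ω)) ⁻¹' {q : (ℂ × Vec S.L × V) × Vec S.L |
      ‖q.2‖ ^ 2 - ‖inner ℂ (u q.1) q.2‖ ^ 2 ∈ s ∧ ψ q.1 ∈ t} := rfl
  rw [h1, ← Measure.map_apply (hDm.prodMk C.measurable_hs) hset, hjoint,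
    Measure.prod_apply hset]
  have h2 : ∀ᵐ d ∂(μ.map D), gaussianVec S.L 1 (Prod.mk d ⁻¹' {q : (ℂ × Vec S.L × V) × Vec S.L |
      ‖q.2‖ ^ 2 - ‖inner ℂ (u q.1) q.2‖ ^ 2 ∈ s ∧ ψ q.1 ∈ t}) =
      gammaMeasure ((S.L : ℝ) - 1) 1 s * (ψ ⁻¹' t).indicator 1 d := by
    filter_upwards [huD] with d hd
    by_cases hdt : ψ d ∈ t
    · rw [Set.indicator_of_mem (show d ∈ ψ ⁻¹' t from hdt), Pi.one_apply, mul_one,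
        ← hres S.one_lt_L (u d) hd, Measure.map_apply (by fun_prop) hs]
      congr 1
      ext h
      simp [hdt]
    · rw [Set.indicator_of_notMem (show d ∉ ψ ⁻¹' t from hdt), mul_zero]
      convert measure_empty (μ := gaussianVec S.L 1)
      ext h
      simp [hdt]
  rw [lintegral_congr_ae h2, lintegral_const_mul _ (measurable_one.indicator (hψm ht)),
    lintegral_indicator_one (hψm ht), Measure.map_apply hDm (hψm ht)]
  rfl

theorem map_residualGain : μ.map C.residualGain = gammaMeasure ((S.L : ℝ) - 1) 1 := by
  have hγ := isProbabilityMeasure_gammaMeasure S.L_sub_one_pos one_pos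
  have hm := C.measurable_interferenceGain.prodMk C.measurable_gp
  have h := congrArg (Measure.map Prod.fst) C.map_residualGain_prod
  have : IsProbabilityMeasure (μ.map fun ω => (C.interferenceGain ω, C.gp ω)) :=
    Measure.isProbabilityMeasure_map hm.aemeasurable
  rw [Measure.map_map measurable_fst (C.measurable_residualGain.prodMk hm),
    Measure.map_fst_prod, measure_univ, one_smul] at h
  exact h

theorem ae_residualGain_pos : ∀ᵐ ω ∂μ, 0 < C.residualGain ω := by
  have h : gammaMeasure ((S.L : ℝ) - 1) 1 (Set.Iic 0) = 0 := by
    rw [gammaMeasure_Iic S.L_sub_one_pos le_rfl, ENNReal.ofReal_eq_zero, sub_nonpos]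
    have hG : 0 < Real.Gamma ((S.L : ℝ) - 1) := Real.Gamma_pos_of_pos S.L_sub_one_pos
    rw [le_div_iff₀ hG, one_mul, incGamma, Real.Gamma_eq_integral S.L_sub_one_pos]
    simp only [mul_comm, le_refl]
  rw [← C.map_residualGain, Measure.map_apply C.measurable_residualGain measurableSet_Iic] at h
  rw [ae_iff]
  simp only [not_lt]
  exact h

theorem measure_eta_le {Pmax t : ℝ} (ht : 0 ≤ t) :
    μ (C.noPrimaryOutage ∩ {ω | C.eta Pmax ω ≤ t}) ≤ ENNReal.ofReal (Real.exp (-S.gainThreshold) *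
      (S.gainThreshold / S.sigma2 * t * (S.lam * ((S.L : ℝ) - 1) * S.maxQuantError))) := by
  have hc : 0 ≤ S.gainThreshold / S.sigma2 * t :=
    mul_nonneg (div_pos S.gainThreshold_pos S.sigma2_pos).le ht
  have hm := C.measurable_interferenceGain.prodMk C.measurable_gp
  have hmW := C.measurable_interferenceGain
  set B : Set (ℝ × ℝ) := {q | q.2 ∈ Set.Icc S.gainThreshold
    (S.gainThreshold + S.gainThreshold / S.sigma2 * t * q.1)} with hB
  have hBm : MeasurableSet B :=
    (measurableSet_le measurable_const measurable_snd).inter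
      (measurableSet_le measurable_snd (by fun_prop))
  have hsub : (C.noPrimaryOutage ∩ {ω | C.eta Pmax ω ≤ t} : Set Ω) ≤ᵐ[μ]
      ((fun ω => (C.interferenceGain ω, C.gp ω)) ⁻¹' B : Set Ω) := by
    filter_upwards [C.ae_interferenceGain_pos] with ω hW hω
    obtain ⟨hM, hle⟩ := hω
    have hle' : C.eta Pmax ω ≤ t := hle
    rw [C.eta_of_mem hM, ← not_lt, S.lt_marginOf_div_iff hW, not_lt] at hle'
    exact ⟨C.mem_noPrimaryOutage.1 hM, hle'⟩
  have hγ := isProbabilityMeasure_gammaMeasure one_pos one_pos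
  calc μ (C.noPrimaryOutage ∩ {ω | C.eta Pmax ω ≤ t})
      ≤ μ ((fun ω => (C.interferenceGain ω, C.gp ω)) ⁻¹' B) := measure_mono_ae hsub
    _ = ∫⁻ w, gammaMeasure 1 1 (Set.Icc S.gainThreshold
          (S.gainThreshold + S.gainThreshold / S.sigma2 * t * w)) ∂(μ.map C.interferenceGain) := by
        rw [← Measure.map_apply hm hBm, C.map_interferenceGain_gp, Measure.prod_apply hBm]
        rfl
    _ ≤ ∫⁻ w, ENNReal.ofReal (Real.exp (-S.gainThreshold)) *
          (ENNReal.ofReal (S.gainThreshold / S.sigma2 * t) * ENNReal.ofReal w)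
          ∂(μ.map C.interferenceGain) := by
        refine lintegral_mono fun w => ?_
        rw [← ENNReal.ofReal_mul hc]
        exact expMeasure_Icc_le S.gainThreshold_pos.le
    _ = _ := by
        rw [lintegral_const_mul _ (by fun_prop), lintegral_const_mul _ (by fun_prop),
          lintegral_map (by fun_prop) hmW, C.lintegral_interferenceGain,
          ← ENNReal.ofReal_mul hc, ← ENNReal.ofReal_mul (Real.exp_pos _).le]

/-- For almost every interference gain the condition confines `g_p` to a nondegenerate interval,
which the exponential law charges. This makes the quantiles of `η` unique. -/
theorem measure_eta_Ioc_ne_zero {Pmax s t : ℝ} (hs : 0 ≤ s) (hst : s < t) :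
    μ (C.noPrimaryOutage ∩ {ω | s < C.eta Pmax ω ∧ C.eta Pmax ω ≤ t}) ≠ 0 := by
  intro h0
  have hc : 0 < S.gainThreshold / S.sigma2 := div_pos S.gainThreshold_pos S.sigma2_pos
  have hm := C.measurable_interferenceGain.prodMk C.measurable_gp
  set a := S.gainThreshold with ha
  set c := a / S.sigma2 with hc'
  set B : Set (ℝ × ℝ) := {q | q.2 ∈ Set.Ioc (a + c * s * q.1) (a + c * t * q.1)} with hB
  have hBm : MeasurableSet B :=
    (measurableSet_lt (by fun_prop) measurable_snd).inter
      (measurableSet_le measurable_snd (by fun_prop))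
  have hsub : ((fun ω => (C.interferenceGain ω, C.gp ω)) ⁻¹' B : Set Ω) ≤ᵐ[μ]
      (C.noPrimaryOutage ∩ {ω | s < C.eta Pmax ω ∧ C.eta Pmax ω ≤ t} : Set Ω) := by
    filter_upwards [C.ae_interferenceGain_pos] with ω hW hω
    have h1 : a + c * s * C.interferenceGain ω < C.gp ω := hω.1
    have h2 : C.gp ω ≤ a + c * t * C.interferenceGain ω := hω.2
    have hM : ω ∈ C.noPrimaryOutage := by
      rw [C.mem_noPrimaryOutage]
      have : 0 ≤ c * s * C.interferenceGain ω := by positivity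
      linarith
    refine ⟨hM, ?_⟩
    change s < C.eta Pmax ω ∧ C.eta Pmax ω ≤ t
    rw [C.eta_of_mem hM]
    refine ⟨(S.lt_marginOf_div_iff hW).2 h1, ?_⟩
    rw [← not_lt, S.lt_marginOf_div_iff hW, not_lt]
    exact h2
  have hγ := isProbabilityMeasure_gammaMeasure one_pos one_pos
  have h1 : μ ((fun ω => (C.interferenceGain ω, C.gp ω)) ⁻¹' B) = 0 :=
    le_antisymm ((measure_mono_ae hsub).trans h0.le) zero_le
  rw [← Measure.map_apply hm hBm, C.map_interferenceGain_gp, Measure.measure_prod_null hBm] at h1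
  have h2 := ae_of_ae_map C.measurable_interferenceGain.aemeasurable h1
  have h3 : ∀ᵐ ω ∂μ, False := by
    filter_upwards [h2, C.ae_interferenceGain_pos] with ω hω hW
    refine expMeasure_Ioc_ne_zero (x := a + c * s * C.interferenceGain ω)
      (y := a + c * t * C.interferenceGain ω) ?_ ?_ hω
    · have := S.gainThreshold_pos
      positivity
    · gcongr
  exact h3.exists.elim fun _ h => h

end Channel

/-! ### Outage bound and its large-power limit -/

namespace Channel

variable {S : Params} {Ω : Type*} [MeasurableSpace Ω] {μ : Measure Ω}
  {V : Type*} [MeasurableSpace V] (C : Channel S μ V)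

theorem measurableSet_outage {Pmax : ℝ} {p : ℕ → ℝ} (hp : C.IsCodebook Pmax p) (x : ℝ) :
    MeasurableSet {ω | C.residualGain ω * C.etahat Pmax p ω ≤ x} :=
  measurableSet_le (C.measurable_residualGain.mul (C.measurable_etahat Pmax hp)) measurable_const

theorem outageProb_eq {Pmax : ℝ} (hP : 0 < Pmax) {p : ℕ → ℝ} (hp : C.IsCodebook Pmax p)
    {f : Ω → Vec S.L}
    (hf : ∀ᵐ ω ∂μ, IsOCBeamformer (C.sxhat ω) (C.ss ω) (C.etahat Pmax p ω) (f ω)) :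
    outageProb C f =
      μ.real {ω | C.residualGain ω * C.etahat Pmax p ω ≤ S.thetaS * S.sigma2} := by
  refine measureReal_congr ?_
  filter_upwards [hf, C.norm_quantizer] with ω h1 (h2 : ‖C.sxhat ω‖ = 1)
  refine propext ?_
  change C.gs ω / S.sigma2 * ‖inner ℂ (f ω) (C.ss ω)‖ ^ 2 ≤ S.thetaS ↔
    C.residualGain ω * C.etahat Pmax p ω ≤ S.thetaS * S.sigma2
  rw [h1.norm_inner_sq (C.etahat_nonneg hP hp ω) h2, div_mul_eq_mul_div, div_le_iff₀ S.sigma2_pos,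
    residualGain, ← norm_sq_mul_shape (C.sxhat ω) (C.hs ω)]
  have : C.gs ω * (C.etahat Pmax p ω * (‖C.ss ω‖ ^ 2 - ‖inner ℂ (C.sxhat ω) (C.ss ω)‖ ^ 2)) =
      ‖C.hs ω‖ ^ 2 * (‖shape (C.hs ω)‖ ^ 2 - ‖inner ℂ (C.sxhat ω) (shape (C.hs ω))‖ ^ 2) *
        C.etahat Pmax p ω := by
    simp only [gs, ss]
    ring
  rw [this]

variable [IsProbabilityMeasure μ]

theorem measure_inter_of_cond {s : Set Ω}
    (h : (ProbabilityTheory.cond μ C.noPrimaryOutage).real s = 1 / (2 : ℝ) ^ S.A) :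
    μ (C.noPrimaryOutage ∩ s) =
      ENNReal.ofReal (Real.exp (-S.gainThreshold) * (2 : ℝ) ^ (-(S.A : ℝ))) := by
  have hM : μ.real C.noPrimaryOutage = Real.exp (-S.gainThreshold) := by
    rw [measureReal_def, C.measure_noPrimaryOutage, ENNReal.toReal_ofReal (Real.exp_pos _).le]
  rw [measureReal_def, cond_apply C.measurableSet_noPrimaryOutage, ENNReal.toReal_mul,
    ENNReal.toReal_inv, ← measureReal_def, ← measureReal_def, hM,
    inv_mul_eq_iff_eq_mul₀ (Real.exp_pos _).ne'] at h
  rw [Real.rpow_neg two_pos.le, Real.rpow_natCast, ← one_div, ← h, measureReal_def,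
    ENNReal.ofReal_toReal (measure_ne_top _ _)]

theorem measure_codebookFloor_le {Pmax : ℝ} {p : ℕ → ℝ} (hp : C.IsCodebook Pmax p) {t : ℝ}
    (ht : 0 ≤ t) :
    μ (C.noPrimaryOutage ∩ {ω | codebookFloor S.A p (C.eta Pmax ω) ≤ t}) ≤
      ENNReal.ofReal (Real.exp (-S.gainThreshold) *
        (S.gainThreshold / S.sigma2 * t * (S.lam * ((S.L : ℝ) - 1) * S.maxQuantError))) +
      ENNReal.ofReal (Real.exp (-S.gainThreshold) * (2 : ℝ) ^ (-(S.A : ℝ))) := by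
  obtain ⟨k, hk, hcell⟩ := exists_cell_of_codebookFloor_le (A := S.A) hp.zero ht
  refine le_trans ?_ (add_le_add (C.measure_eta_le (Pmax := Pmax) ht) le_rfl)
  by_cases hk1 : k + 1 < 2 ^ S.A
  · rw [← C.measure_inter_of_cond (hp.cell k hk1)]
    refine le_trans (measure_mono ?_) (measure_union_le _ _)
    rintro ω ⟨hM, hω⟩
    rcases hcell _ hω with h | h
    · exact Or.inl ⟨hM, h⟩
    · exact Or.inr ⟨hM, h.1, h.2 hk1⟩
  · rw [← C.measure_inter_of_cond hp.last]
    refine le_trans (measure_mono ?_) (measure_union_le _ _)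
    rintro ω ⟨hM, hω⟩
    rcases hcell _ hω with h | h
    · exact Or.inl ⟨hM, h⟩
    · refine Or.inr ⟨hM, ?_⟩
      rw [show 2 ^ S.A - 1 = k by omega]
      exact h.1

/-- Off primary outage `η` ignores the power budget. If `p' (n + 1)` were larger, the cell of `p'`
would be that of `p` plus a nondegenerate interval, of positive mass, although both cells have equal
probability. -/
theorem codebook_le_of_cell {P P' : ℝ} {p p' : ℕ → ℝ} (hp : C.IsCodebook P p)
    (hp' : C.IsCodebook P' p') {n : ℕ} (hn : n + 1 < 2 ^ S.A) (h : p n = p' n) :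
    p' (n + 1) ≤ p (n + 1) := by
  by_contra! hlt
  have hpos : 0 ≤ p (n + 1) := codebook_nonneg hp.zero hp.strictMono hn
  have hle : p n ≤ p (n + 1) :=
    hp.strictMono.monotoneOn (Set.mem_Iio.2 (by omega)) (Set.mem_Iio.2 hn) (Nat.le_succ n)
  have h1 := C.measure_inter_of_cond (hp.cell n hn)
  have h2 := C.measure_inter_of_cond (hp'.cell n hn)
  have hmeas : MeasurableSet
      (C.noPrimaryOutage ∩ {ω | p (n + 1) < C.eta P' ω ∧ C.eta P' ω ≤ p' (n + 1)}) :=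
    C.measurableSet_noPrimaryOutage.inter
      ((measurableSet_lt measurable_const (C.measurable_eta P')).inter
        (measurableSet_le (C.measurable_eta P') measurable_const))
  have hunion : C.noPrimaryOutage ∩ {ω | p' n < C.eta P' ω ∧ C.eta P' ω ≤ p' (n + 1)} =
      (C.noPrimaryOutage ∩ {ω | p n < C.eta P ω ∧ C.eta P ω ≤ p (n + 1)}) ∪
      (C.noPrimaryOutage ∩ {ω | p (n + 1) < C.eta P' ω ∧ C.eta P' ω ≤ p' (n + 1)}) := by
    rw [← Set.inter_union_distrib_left]
    ext ω
    refine and_congr_right fun hM => ?_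
    simp only [Set.mem_ofPred_eq, Set.mem_union, C.eta_of_mem hM, ← h]
    constructor
    · rintro ⟨h3, h4⟩
      rcases le_or_gt (S.marginOf (C.gp ω) / C.interferenceGain ω) (p (n + 1)) with h5 | h5
      · exact Or.inl ⟨h3, h5⟩
      · exact Or.inr ⟨h5, h4⟩
    · rintro (⟨h3, h4⟩ | ⟨h3, h4⟩)
      · exact ⟨h3, h4.trans hlt.le⟩
      · exact ⟨hle.trans_lt h3, h4⟩
  have hdisj : Disjoint (C.noPrimaryOutage ∩ {ω | p n < C.eta P ω ∧ C.eta P ω ≤ p (n + 1)})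
      (C.noPrimaryOutage ∩ {ω | p (n + 1) < C.eta P' ω ∧ C.eta P' ω ≤ p' (n + 1)}) := by
    rw [Set.disjoint_left]
    rintro ω ⟨hM, h3, h4⟩ ⟨-, h5, -⟩
    rw [C.eta_of_mem hM] at h4 h5
    exact absurd h5 (not_lt.2 h4)
  rw [hunion, measure_union hdisj hmeas, h1] at h2
  exact C.measure_eta_Ioc_ne_zero hpos hlt (by
    simpa using (ENNReal.add_right_inj (c := 0) ENNReal.ofReal_ne_top).1 (by rw [h2, add_zero]))

/-- The equal-probability codebook does not depend on the maximum transmit power. -/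
theorem codebook_unique {P P' : ℝ} {p p' : ℕ → ℝ} (hp : C.IsCodebook P p)
    (hp' : C.IsCodebook P' p') : ∀ n < 2 ^ S.A, p n = p' n := by
  intro n
  induction n with
  | zero => intro _; rw [hp.zero, hp'.zero]
  | succ n ih =>
    intro hn
    have h := ih (by omega)
    exact le_antisymm (C.codebook_le_of_cell hp' hp hn h.symm) (C.codebook_le_of_cell hp hp' hn h)

theorem measure_outage_eq_lintegral {Pmax : ℝ} {p : ℕ → ℝ} (hp : C.IsCodebook Pmax p) (x : ℝ) :
    μ {ω | C.residualGain ω * C.etahat Pmax p ω ≤ x} =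
      ∫⁻ g, μ {ω | g * C.etahat Pmax p ω ≤ x} ∂(gammaMeasure ((S.L : ℝ) - 1) 1) := by
  have hm := C.measurable_interferenceGain.prodMk C.measurable_gp
  have hq := S.measurable_etahatOf Pmax hp.zero hp.strictMono
  have hB : MeasurableSet {z : ℝ × (ℝ × ℝ) | z.1 * S.etahatOf Pmax p z.2 ≤ x} :=
    measurableSet_le (measurable_fst.mul (hq.comp measurable_snd)) measurable_const
  have : IsProbabilityMeasure (μ.map fun ω => (C.interferenceGain ω, C.gp ω)) :=
    Measure.isProbabilityMeasure_map hm.aemeasurable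
  have h1 : μ {ω | C.residualGain ω * C.etahat Pmax p ω ≤ x} =
      (μ.map fun ω => (C.residualGain ω, (C.interferenceGain ω, C.gp ω)))
        {z | z.1 * S.etahatOf Pmax p z.2 ≤ x} := by
    rw [Measure.map_apply (C.measurable_residualGain.prodMk hm) hB]
    rfl
  rw [h1, C.map_residualGain_prod, Measure.prod_apply hB]
  refine lintegral_congr fun g => ?_
  rw [Measure.map_apply hm (measurable_prodMk_left hB)]
  rfl

theorem measure_outage_le {Pmax : ℝ} (hP : 0 < Pmax) (hL : 3 ≤ S.L) {p : ℕ → ℝ}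
    (hp : C.IsCodebook Pmax p) :
    μ {ω | C.residualGain ω * C.etahat Pmax p ω ≤ S.thetaS * S.sigma2} ≤
      ENNReal.ofReal (S.outageBound Pmax) := by
  have hr : 0 < S.ratio Pmax := div_pos S.thetaS_pos (div_pos hP S.sigma2_pos)
  have hrP : S.ratio Pmax * Pmax = S.thetaS * S.sigma2 := by
    have := S.sigma2_pos.ne'
    rw [Params.ratio]
    field_simp
  have hL1 := S.L_sub_one_pos
  have hL2 : (0 : ℝ) < (S.L : ℝ) - 1 + -1 := by
    have : (3 : ℝ) ≤ S.L := by exact_mod_cast hL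
    linarith
  have hx : 0 < S.thetaS * S.sigma2 := mul_pos S.thetaS_pos S.sigma2_pos
  have hG : 0 < Real.Gamma ((S.L : ℝ) - 1) := Real.Gamma_pos_of_pos hL1
  set a := S.gainThreshold with ha
  have ha0 : 0 < a := S.gainThreshold_pos
  have hT0 := S.maxQuantError_pos
  have hlam := S.lam_pos
  have hσ := S.sigma2_pos
  set c₁ : ℝ := Real.exp (-a) * (a / S.sigma2 * (S.thetaS * S.sigma2) *
    (S.lam * ((S.L : ℝ) - 1) * S.maxQuantError)) with hc₁
  set c₂ : ℝ := Real.exp (-a) * (2 : ℝ) ^ (-(S.A : ℝ)) with hc₂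
  have hc₁0 : 0 ≤ c₁ := by positivity
  have hc₂0 : 0 ≤ c₂ := by positivity
  have hmain : ∀ g ∈ Set.Ioi (S.ratio Pmax), μ {ω | g * C.etahat Pmax p ω ≤ S.thetaS * S.sigma2} ≤
      ENNReal.ofReal c₁ * ENNReal.ofReal (g ^ (-1 : ℝ)) + ENNReal.ofReal c₂ := by
    intro g hg
    have hg0 : 0 < g := hr.trans hg
    have hsub : {ω | g * C.etahat Pmax p ω ≤ S.thetaS * S.sigma2} ⊆
        C.noPrimaryOutage ∩
          {ω | codebookFloor S.A p (C.eta Pmax ω) ≤ S.thetaS * S.sigma2 / g} := by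
      intro ω hω
      have hω' : g * C.etahat Pmax p ω ≤ S.thetaS * S.sigma2 := hω
      by_cases hc : 0 ≤ C.margin ω ∧ C.eta Pmax ω < Pmax
      · rw [etahat, if_pos hc] at hω'
        exact ⟨C.margin_nonneg_iff.1 hc.1, (le_div_iff₀' hg0).2 hω'⟩
      -- Here `η̂ = Pmax`, and outage would force `g ≤ θ_s / γ_max`.
      · rw [etahat, if_neg hc, ← hrP] at hω'
        exact absurd (le_of_mul_le_mul_right hω' hP) (not_le.2 hg)
    refine (measure_mono hsub).trans ((C.measure_codebookFloor_le hp (by positivity)).trans_eq ?_)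
    rw [← ENNReal.ofReal_mul hc₁0, Real.rpow_neg_one]
    congr 2
    rw [hc₁]
    ring
  rw [C.measure_outage_eq_lintegral hp, ← lintegral_add_compl _ (measurableSet_Iic
    (a := S.ratio Pmax)), Set.compl_Iic]
  calc _ ≤ ∫⁻ _ in Set.Iic (S.ratio Pmax), 1 ∂(gammaMeasure ((S.L : ℝ) - 1) 1) +
        ∫⁻ g in Set.Ioi (S.ratio Pmax),
          (ENNReal.ofReal c₁ * ENNReal.ofReal (g ^ (-1 : ℝ)) + ENNReal.ofReal c₂)
          ∂(gammaMeasure ((S.L : ℝ) - 1) 1) :=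
        add_le_add (lintegral_mono fun _ => prob_le_one)
          (setLIntegral_mono (by fun_prop) hmain)
    _ = ENNReal.ofReal (S.outageBound Pmax) := by
        have hI1 : 0 ≤ 1 - incGamma ((S.L : ℝ) - 1) (S.ratio Pmax) / Real.Gamma ((S.L : ℝ) - 1) := by
          have hγ := isProbabilityMeasure_gammaMeasure hL1 one_pos
          have : gammaMeasure ((S.L : ℝ) - 1) 1 (Set.Ioi (S.ratio Pmax)) ≤ 1 := prob_le_one
          rw [gammaMeasure_Ioi hL1 hr.le, ENNReal.ofReal_le_one] at this
          linarith
        have hI2 := incGamma_nonneg ((S.L : ℝ) - 1 + -1) hr.le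
        have hI3 := incGamma_nonneg ((S.L : ℝ) - 1) hr.le
        rw [setLIntegral_one, lintegral_add_right _ measurable_const,
          lintegral_const_mul _ (by fun_prop), setLIntegral_const,
          setLIntegral_rpow_gammaMeasure hL1 hL2 hr.le, gammaMeasure_Iic hL1 hr.le,
          gammaMeasure_Ioi hL1 hr.le, ← ENNReal.ofReal_mul hc₁0, ← ENNReal.ofReal_mul hc₂0,
          ← ENNReal.ofReal_add (by positivity) (by positivity),
          ← ENNReal.ofReal_add hI1 (by positivity), Params.outageBound, Params.phi, Params.alpha,
          show (S.L : ℝ) - 2 = (S.L : ℝ) - 1 + -1 by ring, add_assoc]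
        congr 2
        rw [hc₁, hc₂, ha, Params.gainThreshold, Params.maxQuantError]
        have hγ := S.gammaP_pos.ne'
        field_simp

/-- In the limit of a large power budget, outage occurs exactly when the primary link is not in
outage and the rounded IPC signal is too small. -/
theorem tendsto_outage {p : ℝ → ℕ → ℝ} (hp : ∀ Pmax : ℝ, 0 < Pmax → C.IsCodebook Pmax (p Pmax))
    (x : ℝ) :
    ∃ ℓ : ℝ, Tendsto (fun Pmax => μ.real {ω | C.residualGain ω * C.etahat Pmax (p Pmax) ω ≤ x})
      atTop (𝓝 ℓ) := by
  have hp1 := hp 1 one_pos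
  set A : Set Ω := C.noPrimaryOutage ∩
    {ω | C.residualGain ω * codebookFloor S.A (p 1) (C.eta 1 ω) ≤ x} with hA
  have hAm : MeasurableSet A := C.measurableSet_noPrimaryOutage.inter
    (measurableSet_le (C.measurable_residualGain.mul
      ((monotone_codebookFloor hp1.zero hp1.strictMono).measurable.comp (C.measurable_eta 1)))
      measurable_const)
  refine ⟨μ.real A, ?_⟩
  -- Codebooks exist only for positive powers; replacing `P` by `max P 1` makes every event
  -- measurable without changing the limit.
  have hpos : ∀ P : ℝ, 0 < max P 1 := fun P => lt_max_of_lt_right one_pos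
  have key : Tendsto (fun P : ℝ => μ {ω | C.residualGain ω *
      C.etahat (max P 1) (p (max P 1)) ω ≤ x}) atTop (𝓝 (μ A)) := by
    refine tendsto_measure_of_ae_tendsto_indicator_of_isFiniteMeasure atTop hAm
      (fun P => C.measurableSet_outage (hp _ (hpos P)) x) ?_
    filter_upwards [C.ae_residualGain_pos] with ω hG
    by_cases hM : ω ∈ C.noPrimaryOutage
    -- Once `P` exceeds `η`, the cap is inactive and `η̂` no longer depends on `P`.
    · filter_upwards [eventually_gt_atTop (C.eta 1 ω)] with P hP
      have hη : C.eta (max P 1) ω = C.eta 1 ω := by rw [C.eta_of_mem hM, C.eta_of_mem hM]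
      have hh : C.etahat (max P 1) (p (max P 1)) ω = codebookFloor S.A (p 1) (C.eta 1 ω) := by
        rw [etahat, if_pos ⟨C.margin_nonneg_iff.2 hM, by rw [hη]; exact lt_max_of_lt_left hP⟩, hη]
        exact codebookFloor_congr (C.codebook_unique (hp _ (hpos P)) hp1) _
      change C.residualGain ω * C.etahat (max P 1) (p (max P 1)) ω ≤ x ↔
        ω ∈ C.noPrimaryOutage ∧ C.residualGain ω * codebookFloor S.A (p 1) (C.eta 1 ω) ≤ x
      rw [hh]
      exact ⟨fun h => ⟨hM, h⟩, fun h => h.2⟩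
    -- In primary outage the full power is used, and since the residual gain is positive this
    -- eventually rules out secondary outage.
    · filter_upwards [eventually_gt_atTop (x / C.residualGain ω)] with P hP
      have hh : C.etahat (max P 1) (p (max P 1)) ω = max P 1 := by
        rw [etahat, if_neg (fun h => hM (C.margin_nonneg_iff.1 h.1))]
      change C.residualGain ω * C.etahat (max P 1) (p (max P 1)) ω ≤ x ↔ ω ∈ A
      rw [hh]
      refine iff_of_false ?_ (fun h => hM h.1)
      rw [not_le]
      exact (div_lt_iff₀' hG).1 (lt_max_of_lt_left hP)
  refine ((ENNReal.tendsto_toReal (measure_ne_top μ A)).comp key).congr' ?_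
  filter_upwards [eventually_ge_atTop 1] with P hP
  simp only [Function.comp_apply, max_eq_left hP, measureReal_def]

end Channel

/-! ### Limit of the explicit bound -/

namespace Params

variable (S : Params)

theorem tendsto_ratio : Tendsto S.ratio atTop (𝓝 0) :=
  (tendsto_id.atTop_div_const S.sigma2_pos).const_div_atTop S.thetaS

theorem tendsto_outageBound (hL : 3 ≤ S.L) : Tendsto S.outageBound atTop (𝓝 S.limitBound) := by
  have hL2 : (0 : ℝ) < (S.L : ℝ) - 2 := by
    have : (3 : ℝ) ≤ S.L := by exact_mod_cast hL
    linarith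
  have hr : ∀ᶠ P in atTop, 0 ≤ S.ratio P := by
    filter_upwards [eventually_ge_atTop 0] with P hP
    exact div_nonneg S.thetaS_pos.le (div_nonneg hP S.sigma2_pos.le)
  have h1 := tendsto_incGamma S.L_sub_one_pos S.tendsto_ratio hr
  have h2 := tendsto_incGamma hL2 S.tendsto_ratio hr
  -- Source of the factor `L - 2` in the denominator of `φ'`.
  have hG1 : Real.Gamma ((S.L : ℝ) - 1) = ((S.L : ℝ) - 2) * Real.Gamma ((S.L : ℝ) - 2) := by
    rw [← Real.Gamma_add_one hL2.ne']
    congr 1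
    ring
  have hG2 : 0 < Real.Gamma ((S.L : ℝ) - 2) := Real.Gamma_pos_of_pos hL2
  have hG : Real.Gamma ((S.L : ℝ) - 1) ≠ 0 := (Real.Gamma_pos_of_pos S.L_sub_one_pos).ne'
  have hI := h1.div_const (Real.Gamma ((S.L : ℝ) - 1))
  rw [div_self hG] at hI
  have hphi : Tendsto S.phi atTop (𝓝 S.phi') := by
    have := ((h2.const_mul (((S.L : ℝ) - 1) * S.lam * S.thetaP * S.thetaS)).div_const
      (S.gammaP * Real.Gamma ((S.L : ℝ) - 1))).const_mul (Real.exp (-(S.thetaP / S.gammaP)))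
    have hval : S.phi' = Real.exp (-(S.thetaP / S.gammaP)) *
        (((S.L : ℝ) - 1) * S.lam * S.thetaP * S.thetaS * Real.Gamma ((S.L : ℝ) - 2) /
          (S.gammaP * Real.Gamma ((S.L : ℝ) - 1))) := by
      have := S.gammaP_pos.ne'
      rw [hG1]
      unfold phi'
      field_simp
    rw [hval]
    exact this
  have halpha : Tendsto S.alpha atTop (𝓝 S.alpha') := by
    have := hI.const_mul (Real.exp (-(S.thetaP / S.gammaP)))
    rw [mul_one] at this
    exact this
  have := ((hI.const_sub 1).add (hphi.mul_const
    ((2 : ℝ) ^ (-((S.B : ℝ) / ((S.L : ℝ) - 1)))))).add (halpha.mul_const ((2 : ℝ) ^ (-(S.A : ℝ))))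
  rw [sub_self, zero_add] at this
  exact this

/-- Needed to pass from the bound by `ENNReal.ofReal`, which truncates at zero, to one between
reals. -/
theorem outageBound_nonneg {Pmax : ℝ} (hP : 0 < Pmax) : 0 ≤ S.outageBound Pmax := by
  have hr : 0 ≤ S.ratio Pmax := (div_pos S.thetaS_pos (div_pos hP S.sigma2_pos)).le
  have hL1 := S.L_sub_one_pos
  have hG : 0 < Real.Gamma ((S.L : ℝ) - 1) := Real.Gamma_pos_of_pos hL1
  have hγ := isProbabilityMeasure_gammaMeasure hL1 one_pos
  have h1 : gammaMeasure ((S.L : ℝ) - 1) 1 (Set.Ioi (S.ratio Pmax)) ≤ 1 := prob_le_one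
  rw [gammaMeasure_Ioi hL1 hr, ENNReal.ofReal_le_one] at h1
  have h2 := incGamma_nonneg ((S.L : ℝ) - 2) hr
  have h3 := incGamma_nonneg ((S.L : ℝ) - 1) hr
  have h4 := S.lam_pos
  have h5 := S.thetaP_pos
  have h6 := S.thetaS_pos
  have h7 := S.gammaP_pos
  have h8 : 0 ≤ 1 - incGamma ((S.L : ℝ) - 1) (S.ratio Pmax) / Real.Gamma ((S.L : ℝ) - 1) := by
    linarith
  unfold outageBound phi alpha
  positivity

end Params

end CognitiveBeamforming

end

theorem mainTheorem6 (S : CognitiveBeamforming.Params) (hL : 3 ≤ S.L)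
    {Ω V : Type*} [MeasurableSpace Ω] [MeasurableSpace V]
    (μ : Measure Ω) [IsProbabilityMeasure μ]
    (C : CognitiveBeamforming.Channel S μ V)
    (p : ℝ → ℕ → ℝ) (hp : ∀ Pmax : ℝ, 0 < Pmax → C.IsCodebook Pmax (p Pmax))
    (f : ℝ → Ω → CognitiveBeamforming.Vec S.L)
    (hf : ∀ Pmax : ℝ, 0 < Pmax → ∀ᵐ ω ∂μ,
      CognitiveBeamforming.IsOCBeamformer (C.sxhat ω) (C.ss ω) (C.etahat Pmax (p Pmax) ω)
        (f Pmax ω)) :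
    (∀ Pmax : ℝ, 0 < Pmax →
      CognitiveBeamforming.outageProb C (f Pmax) ≤ S.outageBound Pmax) ∧
    Tendsto S.outageBound atTop (𝓝 S.limitBound) ∧
    ∃ ℓ : ℝ, Tendsto (fun Pmax => CognitiveBeamforming.outageProb C (f Pmax)) atTop (𝓝 ℓ) ∧
      ℓ ≤ S.limitBound := by
  have hbound : ∀ Pmax : ℝ, 0 < Pmax →
      CognitiveBeamforming.outageProb C (f Pmax) ≤ S.outageBound Pmax := fun Pmax hP => by
    rw [C.outageProb_eq hP (hp Pmax hP) (hf Pmax hP)]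
    exact ENNReal.toReal_le_of_le_ofReal (S.outageBound_nonneg hP)
      (C.measure_outage_le hP hL (hp Pmax hP))
  refine ⟨hbound, S.tendsto_outageBound hL, ?_⟩
  obtain ⟨ℓ, hℓ⟩ := C.tendsto_outage hp (S.thetaS * S.sigma2)
  have hlim : Tendsto (fun Pmax => CognitiveBeamforming.outageProb C (f Pmax)) atTop (𝓝 ℓ) := by
    refine hℓ.congr' ?_
    filter_upwards [eventually_gt_atTop 0] with Pmax hP
    exact (C.outageProb_eq hP (hp Pmax hP) (hf Pmax hP)).symm
  refine ⟨ℓ, hlim, le_of_tendsto_of_tendsto hlim (S.tendsto_outageBound hL) ?_⟩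
  filter_upwards [eventually_gt_atTop 0] with Pmax hP
  exact hbound Pmax hP
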